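/- **Setting.** A finite point measure on $(0,\infty)$ is a finite sum $\mathbf s=\sum_{i=1}^{n}\delta_{s_i}$, $n\ge 0$, $s_i>0$; write $\sharp\mathbf s=n$ and $\langle x^p,\mathbf s\rangle=\sum_{i=1}^n s_i^p$. Let $\alpha\ge 0$ and let $\nu$ be a probability measure on the space of finite point measures on $(0,\infty)$ (with the Borel $\sigma$-algebra of weak convergence). Let $$\underline p=\inf\Big\{p\in\mathbb R:\int\langle x^p,\mathbf s\rangle\,\nu(d\mathbf s)<\infty\Big\},\qquad p_\infty=\inf\Big\{p>\underline p:\int\langle x^p,\mathbf s\rangle\,\nu(d\mathbf s)=\infty\Big\}$$ (with $\inf\emptyset=\infty$) and $\kappa(p)=\int(1-\langle x^p,\mathbf s\rangle)\,\nu(d\mathbf s)$ for $p\in(\underline p,p_\infty)$. Assume that $\kappa$ has a smallest zero $p_0$ in $(\underline p,p_\infty)$, that $p_0>0$, that $\kappa(p)>0$ for some $p>p_0$ in $(\underline p,p_\infty)$, that $\int\langle x^{p_0},\mathbf s\rangle^{p}\,\nu(d\mathbf s)<\infty$ for some $p>1$, and that $\int\sharp\mathbf s\,\nu(d\mathbf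 s)<\infty$. Let $\mathcal U=\bigcup_{n\ge 0}\mathbb N^n$ be the set of nodes, with root $\emptyset$; $|u|$ is the length of $u$, $ui$ is the $i$-th child of $u$, and $v\preceq u$ ($u$ stems from $v$, or $u$ is progeny of $v$) means that $v$ is a prefix of $u$ (possibly $v=u$). Let $(\overline\xi_u)_{u\in\mathcal U}$, $\overline\xi_u=(\widetilde\xi_{ui})_{i\ge 1}$, be i.i.d. random sequences of law $\nu$, meaning that there is a random index $n$ with $\widetilde\xi_{ui}=0\Leftrightarrow i>n$ and that $\sum_{i\le n}\delta_{\widetilde\xi_{ui}}$ has law $\nu$. Let $(\mathbf e_u)_{u\in\mathcal U}$ be i.i.d. exponential variables of parameter $1$, independent of $(\overline\xi_u)_{u\in\mathcal U}$. For $s>0$ the marked tree $T_s=((\xi_u,a_u,\zeta_u))_{u\in\mathcal U}$ with root of size $s$ is given by $\xi_\emptyset=s$, $a_\emptyset=0$, $\zeta_\emptyset=s^{-\alpha}\mathbf e_\emptyset$ and $\xi_{ui}=\widetilde\xi_{ui}\xi_u$, $a_{ui}=a_u+\zeta_u$, $\zeta_{ui}=\xi_{ui}^{-\alpha}\mathbf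 e_{ui}$. Write $\mathbb P_s$, $\mathbb E_s$ for probability and expectation when the marked tree is $T_s$. A line is a set $L\subset\mathcal U$ such that $u,v\in L$, $u\preceq v$ imply $u=v$. Put $\mathcal H_L=\sigma(\widetilde\xi_u,\mathbf e_u:\ u\preceq l\text{ for some }l\in L)$, where $\widetilde\xi_u$ occurs for $u\ne\emptyset$ only. For sets of nodes, $L\preceq Q$ means that each element of $Q$ stems from an element of $L$, and $Q$ covers $L$ if $L\preceq Q$ and each node stemming from $L$ either stems from $Q$ or has progeny in $Q$. Let $|Q|=\sup_{u\in Q}|u|$, let $\mathcal C_0$ be the class of lines $Q$ that cover $\{\emptyset\}$ and satisfy $|Q|<\infty$, and let $M_Q=\sum_{u\in Q}\xi_u^{p_0}$. **Proposition.** 1. Let $L\preceq Q$ be lines and $s>0$. Then $M_Q$ is $\mathbb P_s$-integrable and $\mathbb E_s(M_Q\mid\mathcal H_L)\le M_L$ a.s. If moreover $|Q|<\infty$ and $Q$ covers $L$, then $\mathbb E_s(M_Q\mid\mathcal H_L)=M_L$ a.s. 2. For every $s>0$, the family $\{M_L:\ L\in\mathcal C_0\}$ is uniformly $\mathbb P_s$-integrable.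 3. There is a random variable $M\ge 0$ (one measurable function of the marked tree) such that for every $s>0$: $M$ is $\mathbb P_s$-integrable; $M_L=\mathbb E_s(M\mid\mathcal H_L)$ a.s. for all $L\in\mathcal C_0$; and $M_L\to M$ in $L^1(\mathbb P_s)$ as $L\in\mathcal C_0$ filters for $\preceq$, i.e. for each $\varepsilon>0$ there is $L_0\in\mathcal C_0$ with $\mathbb E_s|M_L-M|<\varepsilon$ for all $L\in\mathcal C_0$ with $L_0\preceq L$. If $\varsigma_n\in\mathcal C_0$, $\varsigma_n\preceq\varsigma_{n+1}$ for all $n$, and each $x\in\mathcal U$ has progeny in some $\varsigma_n$, then also $M_{\varsigma_n}\to M$ $\mathbb P_s$-a.s. as $n\to\infty$. -/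

import Mathlib

open MeasureTheory ProbabilityTheory
open scoped ENNReal

noncomputable section

/-! ### The Ulam-Harris tree, lines and covering lines -/

/-- Nodes of the Ulam-Harris tree are finite words; `[]` is the root, `u ++ [i]` is a child of `u`
(children are numbered from `0`), and `u` stems from `v` if `v <+: u`, i.e. `v` is a prefix
of `u`. -/
abbrev Node : Type := List ℕ

/-- A line: a set of nodes none of which stems from a different one. -/
def IsLine (L : Set Node) : Prop :=
  ∀ u ∈ L, ∀ v ∈ L, u <+: v → u = v

/-- `L ⪯ Q`: every node of `Q` stems from some node of `L`. -/
def Precedes (L Q : Set Node) : Prop :=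
  ∀ v ∈ Q, ∃ u ∈ L, u <+: v

/-- `Q` covers `L`: `L ⪯ Q`, and each individual stemming from `L` either stems from `Q` or has
progeny in `Q`. -/
def Covers (Q L : Set Node) : Prop :=
  Precedes L Q ∧
    ∀ x : Node, (∃ l ∈ L, l <+: x) → (∃ q ∈ Q, q <+: x) ∨ (∃ q ∈ Q, x <+: q)

/-- The generation `|Q| = sup_{u ∈ Q} |u|` of a set of nodes. -/
def maxGeneration (Q : Set Node) : ℕ∞ :=
  ⨆ u ∈ Q, (u.length : ℕ∞)

/-- The class `C₀` of covering lines (lines that cover the root) of finite maximal generation. -/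
def coveringLines : Set (Set Node) :=
  {L | IsLine L ∧ Covers L {([] : Node)} ∧ maxGeneration L < ⊤}

/-! ### Finite point measures and the Malthusian hypotheses -/

/-- Finite point measures on `(0, ∞)`: finite sums of Dirac masses at positive reals (represented
as measures on `ℝ`). The σ-algebra is the one generated by the evaluations `s ↦ s B`, `B` Borel;
it is the Borel σ-algebra of the topology of weak convergence. -/
abbrev FinitePointMeasure : Type :=
  {s : Measure ℝ // ∃ m : Multiset ℝ, (∀ x ∈ m, 0 < x) ∧ s = (m.map Measure.dirac).sum}

/-- `⟨x ^ p, s⟩`, the sum of the `p`-th powers of the atoms of `s`. -/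
def powerSum (p : ℝ) (s : FinitePointMeasure) : ℝ≥0∞ :=
  ∫⁻ x, ENNReal.ofReal (x ^ p) ∂(s : Measure ℝ)

/-- `∫ ⟨x ^ p, s⟩ ν(ds)`. -/
def reproMoment (ν : Measure FinitePointMeasure) (p : ℝ) : ℝ≥0∞ :=
  ∫⁻ s, powerSum p s ∂ν

/-- `inf {p ∈ ℝ : ∫ ⟨x ^ p, s⟩ ν(ds) < ∞}`, an extended real. -/
def pLower (ν : Measure FinitePointMeasure) : EReal :=
  sInf ((fun p : ℝ => (p : EReal)) '' {p : ℝ | reproMoment ν p < ⊤})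

/-- `inf {p > pLower : ∫ ⟨x ^ p, s⟩ ν(ds) = ∞}`, with `inf ∅ = ∞`. -/
def pUpper (ν : Measure FinitePointMeasure) : EReal :=
  sInf ((fun p : ℝ => (p : EReal)) '' {p : ℝ | pLower ν < (p : EReal) ∧ reproMoment ν p = ⊤})

/-- The interval `(pLower, pUpper)` on which `κ` is defined. -/
def kappaDomain (ν : Measure FinitePointMeasure) : Set ℝ :=
  {p : ℝ | pLower ν < (p : EReal) ∧ (p : EReal) < pUpper ν}

/-- `κ(p) = ∫ (1 - ⟨x ^ p, s⟩) ν(ds)`. -/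
def kappa (ν : Measure FinitePointMeasure) (p : ℝ) : ℝ :=
  ∫ s, (1 - (powerSum p s).toReal) ∂ν

/-- `p₀` is the Malthusian exponent of `ν`, i.e. the smallest zero of `κ`, and the Malthusian
hypotheses hold. -/
structure MalthusianHypotheses (ν : Measure FinitePointMeasure) (p₀ : ℝ) : Prop where
  isLeast : IsLeast {p : ℝ | p ∈ kappaDomain ν ∧ kappa ν p = 0} p₀
  pos : 0 < p₀
  exists_kappa_pos : ∃ p ∈ kappaDomain ν, p₀ < p ∧ 0 < kappa ν p
  exists_moment : ∃ p : ℝ, 1 < p ∧ ∫⁻ s, powerSum p₀ s ^ p ∂ν < ⊤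

/-! ### The marked tree -/

section MarkedTree

variable {Ω : Type*}

/-- The random sequence `x` has law `ν`: for a random index `N`, almost surely `x i = 0` exactly
for `i ≥ N` (indices start at `0`), and the point measure `∑_{i < N} δ_{x i}` has law `ν`. -/
def HasReproductionLaw [MeasurableSpace Ω] (P : Measure Ω) (ν : Measure FinitePointMeasure) (x : Ω → ℕ → ℝ) : Prop :=
  ∃ (N : Ω → ℕ) (X : Ω → FinitePointMeasure), HasLaw X ν P ∧
    ∀ᵐ ω ∂P, (∀ i, x ω i = 0 ↔ N ω ≤ i) ∧
      (X ω : Measure ℝ) = ∑ i ∈ Finset.range (N ω), Measure.dirac (x ω i)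

/-- The two independent families of i.i.d. variables from which the marked tree is built: `ξ u` is
the sequence of the relative sizes of the children of `u`, with law `ν` (so `ξ u ω i` is the
relative size of the child `u ++ [i]`), and `e u` is exponential with parameter `1`. -/
structure IsReproductionFamily [MeasurableSpace Ω] (P : Measure Ω) (ν : Measure FinitePointMeasure)
    (ξ : Node → Ω → ℕ → ℝ) (e : Node → Ω → ℝ) : Prop where
  measurable_size : ∀ u, Measurable (ξ u)
  measurable_exp : ∀ u, Measurable (e u)
  size_law : ∀ u, HasReproductionLaw P ν (ξ u)
  size_identDistrib : ∀ u v, IdentDistrib (ξ u) (ξ v) P P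
  size_indep : iIndepFun ξ P
  exp_law : ∀ u, HasLaw (e u) (expMeasure 1) P
  exp_indep : iIndepFun e P
  indep : IndepFun (fun ω u => ξ u ω) (fun ω u => e u ω) P

/-- A mark: size, birth time, lifetime. -/
abbrev Mark : Type := ℝ × ℝ≥0∞ × ℝ≥0∞

/-- The space of marked trees. -/
abbrev MarkedTree : Type := Node → Mark

/-- The mark of an individual of size `x` born at time `a`, whose lifetime is `x ^ (-α) * t`. This
is computed in `[0, ∞]`, so that an individual of size `0` has infinite lifetime if `α > 0`. -/
def mkMark (α x : ℝ) (a : ℝ≥0∞) (t : ℝ) : Mark :=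
  (x, a, ENNReal.ofReal x ^ (-α) * ENNReal.ofReal t)

/-- The mark of the node `v ++ w`, given the mark `c` of the node `v`. -/
def markFrom (α : ℝ) (ξ : Node → ℕ → ℝ) (e : Node → ℝ) : Node → Mark → List ℕ → Mark
  | _, c, [] => c
  | v, c, i :: w =>
      markFrom α ξ e (v ++ [i])
        (mkMark α (ξ v i * c.1) (c.2.1 + c.2.2) (e (v ++ [i]))) w

/-- The marked tree with root of size `x`. -/
def markedTree (α : ℝ) (ξ : Node → Ω → ℕ → ℝ) (e : Node → Ω → ℝ) (x : ℝ) (ω : Ω) : MarkedTree :=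
  fun u => markFrom α (fun v => ξ v ω) (fun v => e v ω) [] (mkMark α x 0 (e [] ω)) u

theorem markFrom_append (α : ℝ) (ξ : Node → ℕ → ℝ) (e : Node → ℝ) (v : Node) (c : Mark)
    (w : List ℕ) (i : ℕ) :
    markFrom α ξ e v c (w ++ [i]) =
      mkMark α (ξ (v ++ w) i * (markFrom α ξ e v c w).1)
        ((markFrom α ξ e v c w).2.1 + (markFrom α ξ e v c w).2.2) (e (v ++ w ++ [i])) := by
  induction w generalizing v c with
  | nil => simp [markFrom]
  | cons j w ih => simp [markFrom, ih]

/-- The mark of the root. -/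
theorem markedTree_root (α : ℝ) (ξ : Node → Ω → ℕ → ℝ) (e : Node → Ω → ℝ) (x : ℝ) (ω : Ω) :
    markedTree α ξ e x ω [] = mkMark α x 0 (e [] ω) := rfl

/-- The recursion that defines the marked tree. -/
theorem markedTree_child (α : ℝ) (ξ : Node → Ω → ℕ → ℝ) (e : Node → Ω → ℝ) (x : ℝ) (ω : Ω)
    (u : Node) (i : ℕ) :
    markedTree α ξ e x ω (u ++ [i]) =
      mkMark α (ξ u ω i * (markedTree α ξ e x ω u).1)
        ((markedTree α ξ e x ω u).2.1 + (markedTree α ξ e x ω u).2.2) (e (u ++ [i]) ω) := by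
  simp [markedTree, markFrom_append]

/-- The pre-`L` σ-algebra, generated by the relative sizes of the nodes `u ++ [i]` and the
exponential variables of the nodes `u` from which some node of `L` stems. -/
@[reducible]
def preSigma (ξ : Node → Ω → ℕ → ℝ) (e : Node → Ω → ℝ) (L : Set Node) : MeasurableSpace Ω :=
  (⨆ (u : Node) (i : ℕ) (_ : ∃ l ∈ L, (u ++ [i]) <+: l),
      MeasurableSpace.comap (fun ω => ξ u ω i) inferInstance) ⊔
    ⨆ (u : Node) (_ : ∃ l ∈ L, u <+: l), MeasurableSpace.comap (e u) inferInstance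

/-- The intrinsic process `M_Q = ∑_{u ∈ Q} ξ_u ^ p₀`, as a function of the marked tree with values
in `[0, ∞]`. -/
def intrinsicSum (p₀ : ℝ) (Q : Set Node) (T : MarkedTree) : ℝ≥0∞ :=
  ∑' u : Q, ENNReal.ofReal ((T u).1 ^ p₀)

/-- The intrinsic process as a real-valued function. -/
def intrinsic (p₀ : ℝ) (Q : Set Node) (T : MarkedTree) : ℝ :=
  (intrinsicSum p₀ Q T).toReal

end MarkedTree

end

/-! Write `m i` for the mean `p₀`-th power of the `i`-th relative size. The Malthusian condition
says exactly that the `m i` sum to `1`. Along a path leading down from a node `l` of a line `L`,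
each further relative size is independent of the past and of `preSigma ξ e L`, so on events `A` of
that σ-algebra the mean weight of `l ++ w` is the product of `m` over the letters of `w` times the
mean weight of `l`. Hence the mean of `M_Q` on `A` is the sum over `l` of a Kraft sum, over the
words from `l` to `Q`, times the mean weight of `l` (`setLIntegral_intrinsicSum`). Kraft sums are at
most `1` for lines and equal to `1` for bounded covering lines, which gives the inequality and the
equality for conditional expectations.

For the limit, the generations are enough. Convexity of the moments in the exponent gives `r > 0`
with `reproMoment ν (p₀ * (1 + r)) < 1`; the increase of the `(1 + r)`-th moment from generation `n`
to `n + 1` is then at most geometric in `n` (`lintegral_intrinsicSum_rpow_succ_le`). So the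
generation martingale is uniformly integrable and converges a.s. and in `L¹` to a variable `M`. A
bounded covering line is covered by all late generations, so `M_L` is the conditional expectation of
`M` (`intrinsic_ae_eq_condExp`). Uniform integrability over all covering lines, the filtering limit
and, by Lévy's upward theorem, the a.s. limit follow. -/

noncomputable section

/-! ### Combinatorics of lines -/

/-- The nodes of generation `n`. -/
def generation (n : ℕ) : Set Node := {u | u.length = n}

/-- The words that lead from `l` to a node of `Q`. -/
def wordsFrom (l : Node) (Q : Set Node) : Set Node := {w | l ++ w ∈ Q}

/-- Every node has an ancestor or progeny in `Q`. -/
def CoversRoot (Q : Set Node) : Prop := ∀ w : Node, (∃ q ∈ Q, q <+: w) ∨ (∃ q ∈ Q, w <+: q)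

theorem IsLine.eq_of_prefix_of_prefix {L : Set Node} (hL : IsLine L) {u v w : Node} (hu : u ∈ L)
    (hv : v ∈ L) (huw : u <+: w) (hvw : v <+: w) : u = v := by
  rcases List.prefix_or_prefix_of_prefix huw hvw with h | h
  · exact hL u hu v hv h
  · exact (hL v hv u hu h).symm

theorem IsLine.wordsFrom {Q : Set Node} (hQ : IsLine Q) (l : Node) : IsLine (wordsFrom l Q) :=
  fun _ hu _ hv huv => List.append_cancel_left
    (hQ _ hu _ hv ((List.prefix_append_right_inj l).2 huv))

theorem isLine_generation (n : ℕ) : IsLine (generation n) :=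
  fun _ hu _ hv h => h.eq_of_length (Eq.trans hu (Eq.symm hv))

theorem exists_length_le_of_maxGeneration_lt_top {Q : Set Node} (hQ : maxGeneration Q < ⊤) :
    ∃ n, ∀ u ∈ Q, u.length ≤ n := by
  refine ⟨(maxGeneration Q).toNat, fun u hu => ?_⟩
  have h : (u.length : ℕ∞) ≤ maxGeneration Q := le_iSup₂ (f := fun (u : Node) (_ : u ∈ Q) => (u.length : ℕ∞)) u hu
  rw [← ENat.natCast_toNat hQ.ne] at h
  exact_mod_cast h

/-- Covering is inherited by the subtree at `l`: a node of `Q` above `l ++ w` has an ancestor in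
`L`, which must be `l` because `L` is a line. -/
theorem Covers.coversRoot_wordsFrom {L Q : Set Node} (hL : IsLine L) (h : Covers Q L) {l : Node}
    (hl : l ∈ L) : CoversRoot (wordsFrom l Q) := by
  intro w
  rcases h.2 (l ++ w) ⟨l, hl, List.prefix_append l w⟩ with ⟨q, hq, hqw⟩ | ⟨q, hq, hqw⟩
  · obtain ⟨l', hl', hlq⟩ := h.1 q hq
    obtain rfl := hL.eq_of_prefix_of_prefix hl' hl (hlq.trans hqw) (List.prefix_append l w)
    obtain ⟨w', rfl⟩ := hlq
    exact Or.inl ⟨w', hq, (List.prefix_append_right_inj l').1 hqw⟩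
  · obtain ⟨t, rfl⟩ := hqw
    exact Or.inr ⟨w ++ t, by simpa [wordsFrom, List.append_assoc] using hq, List.prefix_append w t⟩

theorem generation_mem_coveringLines (n : ℕ) : generation n ∈ coveringLines := by
  refine ⟨isLine_generation n, ⟨fun v _ => ⟨[], rfl, List.nil_prefix⟩, fun x _ => ?_⟩, ?_⟩
  · rcases le_total n x.length with h | h
    · exact Or.inl ⟨x.take n, by simp [generation, h], List.take_prefix n x⟩
    · exact Or.inr ⟨x ++ List.replicate (n - x.length) 0, by simp [generation, h],
        List.prefix_append _ _⟩
  · refine lt_of_le_of_lt (iSup₂_le fun u (hu : u.length = n) => ?_) (ENat.natCast_lt_top n)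
    rw [hu]

theorem coversRoot_of_mem_coveringLines {L : Set Node} (hL : L ∈ coveringLines) :
    CoversRoot L := fun w => hL.2.1.2 w ⟨[], rfl, List.nil_prefix⟩

/-- If `L ⪯ Q` and `Q` covers the root, then each node of `L` has progeny in `Q`. -/
theorem Precedes.exists_progeny {L Q : Set Node} (hL : IsLine L) (hLQ : Precedes L Q)
    (hQ : CoversRoot Q) {u : Node} (hu : u ∈ L) : ∃ q ∈ Q, u <+: q := by
  rcases hQ u with ⟨q, hq, hqu⟩ | h
  · obtain ⟨v, hv, hvq⟩ := hLQ q hq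
    obtain rfl := hL v hv u hu (hvq.trans hqu)
    exact ⟨q, hq, hvq⟩
  · exact h

/-- A node at least as long as all nodes of `L` cannot be a strict prefix of one, so it stems from
`L`. This makes the generations cofinal among the bounded covering lines. -/
theorem exists_covers_generation {L : Set Node} (hL : L ∈ coveringLines) :
    ∃ n, ∀ m, n ≤ m → Covers (generation m) L := by
  obtain ⟨n, hn⟩ := exists_length_le_of_maxGeneration_lt_top hL.2.2
  refine ⟨n, fun m hm => ⟨fun v hv => ?_, fun x _ =>
    coversRoot_of_mem_coveringLines (generation_mem_coveringLines m) x⟩⟩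
  rcases coversRoot_of_mem_coveringLines hL v with h | ⟨q, hq, hvq⟩
  · exact h
  · have hv' : v.length = m := hv
    have := hvq.eq_of_length_le (by rw [hv']; exact (hn q hq).trans hm)
    exact ⟨q, hq, this ▸ hvq⟩

/-- The nodes of a line `Q` that follows the line `L`, sorted by their ancestors in `L`. -/
def lineEquiv {L Q : Set Node} (hL : IsLine L) (hLQ : Precedes L Q) :
    (Σ l : L, wordsFrom (l : Node) Q) ≃ Q :=
  Equiv.ofBijective (fun p => ⟨(p.1 : Node) ++ (p.2 : Node), p.2.2⟩) <| by
    constructor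
    · rintro ⟨⟨l, hl⟩, ⟨w, hw⟩⟩ ⟨⟨l', hl'⟩, ⟨w', hw'⟩⟩ h
      have h' : l ++ w = l' ++ w' := congrArg Subtype.val h
      obtain rfl := hL.eq_of_prefix_of_prefix hl hl' (List.prefix_append l w)
        (h' ▸ List.prefix_append l' w')
      obtain rfl := List.append_cancel_left h'
      rfl
    · rintro ⟨v, hv⟩
      obtain ⟨l, hl, w, rfl⟩ := hLQ v hv
      exact ⟨⟨⟨l, hl⟩, ⟨w, hv⟩⟩, rfl⟩

/-- The nodes of generation `n + 1` as children of nodes of generation `n`. -/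
def generationSuccEquiv (n : ℕ) : generation n × ℕ ≃ generation (n + 1) :=
  Equiv.ofBijective (fun p => ⟨(p.1 : Node) ++ [p.2], by
      have : (p.1 : Node).length = n := p.1.2
      simp [generation, this]⟩) <| by
    constructor
    · rintro ⟨⟨u, hu⟩, i⟩ ⟨⟨v, hv⟩, j⟩ h
      have h' : u ++ [i] = v ++ [j] := congrArg Subtype.val h
      obtain ⟨rfl, h2⟩ := List.append_inj' h' rfl
      simp at h2
      rw [h2]
    · rintro ⟨v, hv⟩
      have hv' : v.length = n + 1 := hv
      rcases List.eq_nil_or_concat' v with rfl | ⟨u, i, rfl⟩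
      · simp at hv'
      · exact ⟨⟨⟨u, by simpa [generation] using hv'⟩, i⟩, rfl⟩

/-- The nonempty words of a set, sorted by their first letter. -/
def consEquiv {Q : Set Node} (hQ : [] ∉ Q) : (Σ i : ℕ, wordsFrom [i] Q) ≃ Q :=
  Equiv.ofBijective (fun p => ⟨p.1 :: (p.2 : Node), p.2.2⟩) <| by
    constructor
    · rintro ⟨i, ⟨w, hw⟩⟩ ⟨j, ⟨w', hw'⟩⟩ h
      have h' : i :: w = j :: w' := congrArg Subtype.val h
      obtain ⟨rfl, rfl⟩ := List.cons_eq_cons.1 h'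
      rfl
    · rintro ⟨v, hv⟩
      cases v with
      | nil => exact absurd hv hQ
      | cons i w => exact ⟨⟨i, ⟨w, hv⟩⟩, rfl⟩

/-! ### Kraft sums over lines. -/

theorem tsum_line_eq_one_of_nil_mem {Q : Set Node} (hQ : IsLine Q) (h : [] ∈ Q) (m : ℕ → ℝ≥0∞) :
    ∑' w : Q, ((w : Node).map m).prod = 1 := by
  have : Q = {[]} := Set.eq_singleton_iff_unique_mem.2
    ⟨h, fun w hw => (hQ [] h w hw List.nil_prefix).symm⟩
  subst this
  rw [tsum_singleton ([] : Node) (fun w : Node => (w.map m).prod)]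
  simp

theorem tsum_line_eq_tsum_wordsFrom {Q : Set Node} (h : [] ∉ Q) (m : ℕ → ℝ≥0∞) :
    ∑' w : Q, ((w : Node).map m).prod =
      ∑' i, m i * ∑' w : wordsFrom [i] Q, ((w : Node).map m).prod := by
  rw [← (consEquiv h).tsum_eq, ENNReal.tsum_sigma']
  refine tsum_congr fun i => ?_
  rw [← ENNReal.tsum_mul_left]
  rfl

theorem length_le_of_mem_wordsFrom_singleton {Q : Set Node} {n i : ℕ}
    (hn : ∀ u ∈ Q, u.length ≤ n + 1) : ∀ u ∈ wordsFrom [i] Q, u.length ≤ n := by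
  intro u hu
  have := hn _ hu
  simpa using this

/-- A line that contains the root is the root alone; any other line splits by first letter into
lines of shorter words. -/
theorem tsum_line_le_one_of_length_le {m : ℕ → ℝ≥0∞} (hm : ∑' i, m i ≤ 1) (n : ℕ) :
    ∀ {Q : Set Node}, IsLine Q → (∀ u ∈ Q, u.length ≤ n) →
      ∑' w : Q, ((w : Node).map m).prod ≤ 1 := by
  induction n with
  | zero =>
    intro Q hQ hn
    by_cases h : [] ∈ Q
    · exact (tsum_line_eq_one_of_nil_mem hQ h m).le
    · have : Q = ∅ := Set.eq_empty_iff_forall_notMem.2 fun w hw => h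
        (List.length_eq_zero_iff.1 (Nat.le_zero.1 (hn w hw)) ▸ hw)
      subst this
      simp
  | succ n ih =>
    intro Q hQ hn
    by_cases h : [] ∈ Q
    · exact (tsum_line_eq_one_of_nil_mem hQ h m).le
    · rw [tsum_line_eq_tsum_wordsFrom h]
      refine le_trans (ENNReal.tsum_le_tsum fun i => ?_) hm
      exact mul_le_of_le_one_right' (ih (hQ.wordsFrom [i]) (length_le_of_mem_wordsFrom_singleton hn))

/-- Kraft's inequality for lines. -/
theorem tsum_line_le_one {m : ℕ → ℝ≥0∞} (hm : ∑' i, m i ≤ 1) {Q : Set Node} (hQ : IsLine Q) :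
    ∑' w : Q, ((w : Node).map m).prod ≤ 1 := by
  rw [ENNReal.tsum_eq_iSup_sum]
  refine iSup_le fun s => ?_
  -- The nodes of a finite partial sum form a line of bounded length.
  have h1 := tsum_line_le_one_of_length_le hm (s.sup fun w => (w : Node).length)
    (Q := {w | ∃ h : w ∈ Q, (⟨w, h⟩ : Q) ∈ s})
    (fun u ⟨hu, _⟩ v ⟨hv, _⟩ h => hQ u hu v hv h)
    (fun u ⟨hu, hs⟩ => Finset.le_sup (f := fun w : Q => (w : Node).length) hs)
  refine le_trans ?_ h1
  rw [← Finset.tsum_subtype]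
  exact ENNReal.tsum_comp_le_tsum_of_injective
    (f := fun w : s => (⟨w.1.1, w.1.2, w.2⟩ : {w | ∃ h : w ∈ Q, (⟨w, h⟩ : Q) ∈ s}))
    (fun a b h => Subtype.ext (Subtype.ext (Subtype.mk.inj h)))
    (fun w => ((w : Node).map m).prod)

/-- Kraft's equality for bounded covering lines. -/
theorem tsum_line_eq_one {m : ℕ → ℝ≥0∞} (hm : ∑' i, m i = 1) (n : ℕ) :
    ∀ {Q : Set Node}, IsLine Q → (∀ u ∈ Q, u.length ≤ n) → CoversRoot Q →
      ∑' w : Q, ((w : Node).map m).prod = 1 := by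
  induction n with
  | zero =>
    intro Q hQ hn hc
    refine tsum_line_eq_one_of_nil_mem hQ ?_ m
    rcases hc [] with ⟨q, hq, _⟩ | ⟨q, hq, _⟩ <;>
    exact List.length_eq_zero_iff.1 (Nat.le_zero.1 (hn q hq)) ▸ hq
  | succ n ih =>
    intro Q hQ hn hc
    by_cases h : [] ∈ Q
    · exact tsum_line_eq_one_of_nil_mem hQ h m
    · rw [tsum_line_eq_tsum_wordsFrom h, ← hm]
      refine tsum_congr fun i => ?_
      rw [ih (hQ.wordsFrom [i]) (length_le_of_mem_wordsFrom_singleton hn), mul_one]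
      -- Since the root is not in `Q`, a node of `Q` comparable with `i :: w` begins with `i`, so
      -- the words after `i` cover again.
      intro w
      rcases hc (i :: w) with ⟨q, hq, hqw⟩ | ⟨q, hq, hqw⟩
      · cases q with
        | nil => exact absurd hq h
        | cons j q =>
          obtain ⟨rfl, hqw'⟩ := List.cons_prefix_cons.1 hqw
          exact Or.inl ⟨q, hq, hqw'⟩
      · cases q with
        | nil => exact absurd hq h
        | cons j q =>
          obtain ⟨rfl, hqw'⟩ := List.cons_prefix_cons.1 hqw
          exact Or.inr ⟨q, hq, hqw'⟩

/-! ### Moments of the reproduction law -/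

theorem measurable_powerSum (p : ℝ) : Measurable (powerSum p) :=
  (Measure.measurable_lintegral (f := fun x : ℝ => ENNReal.ofReal (x ^ p))
    (by fun_prop)).comp measurable_subtype_coe

theorem FinitePointMeasure.measure_Iic_zero (s : FinitePointMeasure) :
    (s : Measure ℝ) (Set.Iic 0) = 0 := by
  obtain ⟨s, m, hm, rfl⟩ := s
  show (m.map Measure.dirac).sum (Set.Iic (0 : ℝ)) = 0
  induction m using Multiset.induction_on with
  | empty => simp
  | cons a m ih =>
    have ha := hm a (Multiset.mem_cons_self a m)
    rw [Multiset.map_cons, Multiset.sum_cons, Measure.add_apply,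
      ih fun x hx => hm x (Multiset.mem_cons_of_mem hx)]
    simp [ha]

theorem FinitePointMeasure.ae_pos (s : FinitePointMeasure) : ∀ᵐ x ∂(s : Measure ℝ), 0 < x := by
  rw [ae_iff]
  convert s.measure_Iic_zero using 2
  ext x
  simp

/-- For each atom `x > 0` the power `x ^ p` is log-convex in `p`, hence convex by the weighted AM-GM
inequality. -/
theorem powerSum_convex {p q t : ℝ} (ht₀ : 0 ≤ t) (ht₁ : t ≤ 1) (s : FinitePointMeasure) :
    powerSum ((1 - t) * p + t * q) s ≤
      ENNReal.ofReal (1 - t) * powerSum p s + ENNReal.ofReal t * powerSum q s := by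
  unfold powerSum
  rw [← lintegral_const_mul _ (by fun_prop), ← lintegral_const_mul _ (by fun_prop),
    ← lintegral_add_left (by fun_prop)]
  refine lintegral_mono_ae (s.ae_pos.mono fun x hx => ?_)
  have ht : 0 ≤ 1 - t := sub_nonneg.2 ht₁
  rw [← ENNReal.ofReal_mul ht, ← ENNReal.ofReal_mul ht₀, ← ENNReal.ofReal_add
    (mul_nonneg ht (Real.rpow_nonneg hx.le _)) (mul_nonneg ht₀ (Real.rpow_nonneg hx.le _))]
  refine ENNReal.ofReal_le_ofReal ?_
  rw [Real.rpow_add hx, mul_comm (1 - t) p, mul_comm t q, Real.rpow_mul hx.le, Real.rpow_mul hx.le]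
  exact Real.geom_mean_le_arith_mean2_weighted ht ht₀ (Real.rpow_nonneg hx.le _)
    (Real.rpow_nonneg hx.le _) (by ring)

section

variable {ν : Measure FinitePointMeasure}

theorem reproMoment_lt_top {p : ℝ} (hp : p ∈ kappaDomain ν) : reproMoment ν p < ⊤ := by
  by_contra h
  exact hp.2.not_ge (sInf_le ⟨p, ⟨hp.1, not_lt_top_iff.1 h⟩, rfl⟩)

/-- On the domain the moment is finite, so the Bochner integral is not a default value and `toReal`
loses nothing. -/
theorem kappa_eq [IsProbabilityMeasure ν] {p : ℝ} (hp : p ∈ kappaDomain ν) :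
    kappa ν p = 1 - (reproMoment ν p).toReal := by
  have hfin : ∫⁻ s, powerSum p s ∂ν ≠ ⊤ := (reproMoment_lt_top hp).ne
  have hae : ∀ᵐ s ∂ν, powerSum p s < ⊤ := ae_lt_top (measurable_powerSum p) hfin
  unfold kappa reproMoment
  rw [integral_sub (integrable_const _)
    (integrable_toReal_of_lintegral_ne_top (measurable_powerSum p).aemeasurable hfin),
    integral_toReal (measurable_powerSum p).aemeasurable hae]
  simp

namespace MalthusianHypotheses

variable [IsProbabilityMeasure ν] {p₀ : ℝ}

theorem reproMoment_eq_one (h : MalthusianHypotheses ν p₀) : reproMoment ν p₀ = 1 := by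
  obtain ⟨hp, h0⟩ := h.isLeast.1
  rw [kappa_eq hp, sub_eq_zero] at h0
  rw [← ENNReal.ofReal_toReal (reproMoment_lt_top hp).ne, ← h0, ENNReal.ofReal_one]

/-- An exponent `1 + r` with which the intrinsic martingale will be bounded. -/
theorem exists_exponent (h : MalthusianHypotheses ν p₀) :
    ∃ r : ℝ, 0 < r ∧ r < 1 ∧ reproMoment ν (p₀ * (1 + r)) < 1 ∧
      ∫⁻ s, powerSum p₀ s ^ (1 + r) ∂ν < ⊤ := by
  obtain ⟨p, hp, hpp, hk⟩ := h.exists_kappa_pos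
  obtain ⟨q, hq1, hq⟩ := h.exists_moment
  have h0 := h.pos
  have hmp : reproMoment ν p < 1 := by
    rw [kappa_eq hp, sub_pos] at hk
    rw [← ENNReal.ofReal_toReal (reproMoment_lt_top hp).ne]
    exact ENNReal.ofReal_lt_one.2 hk
  -- The three bounds give `r < 1`, `1 + r ≤ q` and `p₀ * (1 + r) ≤ p`.
  set r := min (1 / 2) (min (q - 1) ((p - p₀) / p₀)) with hr
  have hd : 0 < p - p₀ := sub_pos.2 hpp
  have hr0 : 0 < r := lt_min (by norm_num) (lt_min (sub_pos.2 hq1) (div_pos hd h0))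
  have hr1 : r ≤ 1 / 2 := min_le_left _ _
  have hrq : r ≤ q - 1 := (min_le_right _ _).trans (min_le_left _ _)
  have hrp : r ≤ (p - p₀) / p₀ := (min_le_right _ _).trans (min_le_right _ _)
  rw [le_div_iff₀ h0] at hrp
  refine ⟨r, hr0, by linarith, ?_, ?_⟩
  -- This `t` places `p₀ * (1 + r)` between `p₀`, where the moment is `1`, and `p`, where it is
  -- below `1`; convexity and `t > 0` make the inequality strict.
  · set t := r * p₀ / (p - p₀) with ht
    have ht0 : 0 < t := div_pos (mul_pos hr0 h0) hd
    have ht1 : t ≤ 1 := (div_le_one hd).2 hrp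
    have hexp : p₀ * (1 + r) = (1 - t) * p₀ + t * p := by
      rw [ht]; field_simp; ring
    calc reproMoment ν (p₀ * (1 + r))
        ≤ ∫⁻ s, (ENNReal.ofReal (1 - t) * powerSum p₀ s + ENNReal.ofReal t * powerSum p s) ∂ν := by
          rw [hexp]
          exact lintegral_mono fun s => powerSum_convex ht0.le ht1 s
      _ = ENNReal.ofReal (1 - t) * reproMoment ν p₀ + ENNReal.ofReal t * reproMoment ν p := by
          rw [lintegral_add_left ((measurable_powerSum p₀).const_mul _),
            lintegral_const_mul _ (measurable_powerSum p₀),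
            lintegral_const_mul _ (measurable_powerSum p)]
          rfl
      _ < ENNReal.ofReal (1 - t) * 1 + ENNReal.ofReal t * 1 := by
          rw [h.reproMoment_eq_one]
          refine ENNReal.add_lt_add_left (by simp) ?_
          exact ENNReal.mul_lt_mul_right (ENNReal.ofReal_pos.2 ht0).ne' ENNReal.ofReal_ne_top hmp
      _ = 1 := by
          rw [mul_one, mul_one, ← ENNReal.ofReal_add (sub_nonneg.2 ht1) ht0.le]
          simp
  · calc ∫⁻ s, powerSum p₀ s ^ (1 + r) ∂ν ≤ ∫⁻ s, (1 + powerSum p₀ s ^ q) ∂ν := by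
          refine lintegral_mono fun s => ?_
          rcases le_total (powerSum p₀ s) 1 with hs | hs
          · exact (ENNReal.rpow_le_one hs (by linarith)).trans le_self_add
          · exact (ENNReal.rpow_le_rpow_of_exponent_le hs (by linarith)).trans le_add_self
      _ < ⊤ := by
          rw [lintegral_add_left measurable_const]
          simpa using hq

end MalthusianHypotheses

end

/-! ### Sequences with the reproduction law -/

section

variable {Ω : Type*} [MeasurableSpace Ω] {P : Measure Ω} {ν : Measure FinitePointMeasure}
  {x : Ω → ℕ → ℝ}

/-- A negative entry would be an atom in `Set.Iic 0`, which point measures on `(0, ∞)` do not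
charge. -/
theorem HasReproductionLaw.ae_nonneg (h : HasReproductionLaw P ν x) :
    ∀ᵐ ω ∂P, ∀ i, 0 ≤ x ω i := by
  obtain ⟨N, X, -, hX⟩ := h
  filter_upwards [hX] with ω ⟨h0, hω⟩ i
  rcases le_or_gt (N ω) i with hi | hi
  · exact ((h0 i).2 hi).ge
  · have h1 := (X ω).measure_Iic_zero
    rw [hω, Measure.finsetSum_apply] at h1
    have h2 := Finset.sum_eq_zero_iff.1 h1 i (Finset.mem_range.2 hi)
    by_contra hlt
    simp [Set.indicator, (not_le.1 hlt).le] at h2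

theorem HasReproductionLaw.lintegral_comp_tsum (h : HasReproductionLaw P ν x) {p : ℝ} (hp : p ≠ 0)
    {φ : ℝ≥0∞ → ℝ≥0∞} (hφ : Measurable φ) :
    ∫⁻ ω, φ (∑' i, ENNReal.ofReal (x ω i ^ p)) ∂P = ∫⁻ s, φ (powerSum p s) ∂ν := by
  obtain ⟨N, X, hlaw, hX⟩ := h
  rw [← hlaw.lintegral_comp (f := fun s => φ (powerSum p s))
    (hφ.comp (measurable_powerSum p)).aemeasurable]
  refine lintegral_congr_ae ?_
  filter_upwards [hX] with ω ⟨h0, hω⟩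
  congr 1
  unfold powerSum
  rw [hω, lintegral_finsetSum_measure, tsum_eq_sum (s := Finset.range (N ω))]
  · refine Finset.sum_congr rfl fun i _ => ?_
    rw [lintegral_dirac' _ (by fun_prop)]
  · intro i hi
    -- Here `p ≠ 0` matters: the absent children have size `0`, and `0 ^ 0` would be `1`.
    rw [(h0 i).2 (by simpa using hi), Real.zero_rpow hp, ENNReal.ofReal_zero]

end

/-! ### Independence along the tree -/

theorem measurable_ennreal_tsum {Ω ι : Type*} [Countable ι] {m : MeasurableSpace Ω}
    {f : ι → Ω → ℝ≥0∞} (hf : ∀ i, Measurable[m] (f i)) : Measurable[m] fun ω => ∑' i, f i ω :=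
  Measurable.tsum hf

/-- The intersections `B ∩ C` form a π-system generating `m₂ ⊔ m₃`, and on it the product formula
follows by splitting off `C`, then `B`. It combines the independence among the sizes with that
between sizes and exponential variables. -/
theorem indep_sup_right {Ω : Type*} {m0 m₁ m₂ m₃ : MeasurableSpace Ω} {P : Measure[m0] Ω}
    [IsZeroOrProbabilityMeasure P] (h₁ : m₁ ≤ m0) (h₂ : m₂ ≤ m0) (h₃ : m₃ ≤ m0)
    (h₁₂ : Indep m₁ m₂ P) (h : Indep (m₁ ⊔ m₂) m₃ P) : Indep m₁ (m₂ ⊔ m₃) P := by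
  have hgen : m₂ ⊔ m₃ = MeasurableSpace.generateFrom
      {s | ∃ B C, MeasurableSet[m₂] B ∧ MeasurableSet[m₃] C ∧ s = B ∩ C} := by
    refine le_antisymm (sup_le (fun s hs => ?_) (fun s hs => ?_))
      (MeasurableSpace.generateFrom_le ?_)
    · exact MeasurableSpace.measurableSet_generateFrom ⟨s, Set.univ, hs, .univ, by simp⟩
    · exact MeasurableSpace.measurableSet_generateFrom ⟨Set.univ, s, .univ, hs, by simp⟩
    · rintro s ⟨B, C, hB, hC, rfl⟩
      exact MeasurableSet.inter (le_sup_left (b := m₃) _ hB) (le_sup_right (a := m₂) _ hC)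
  refine IndepSets.indep h₁ (sup_le h₂ h₃) (@MeasurableSpace.isPiSystem_measurableSet _ m₁) ?_
    (@MeasurableSpace.generateFrom_measurableSet _ m₁).symm hgen ?_
  · rintro _ ⟨B, C, hB, hC, rfl⟩ _ ⟨B', C', hB', hC', rfl⟩ -
    exact ⟨B ∩ B', C ∩ C', hB.inter hB', hC.inter hC', Set.inter_inter_inter_comm ..⟩
  · rw [IndepSets_iff]
    rintro A _ hA ⟨B, C, hB, hC, rfl⟩
    have hA' : MeasurableSet[m₁ ⊔ m₂] A := le_sup_left (b := m₂) _ hA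
    have hB' : MeasurableSet[m₁ ⊔ m₂] B := le_sup_right (a := m₁) _ hB
    rw [Indep_iff] at h h₁₂
    rw [← Set.inter_assoc, h _ _ (hA'.inter hB') hC, h _ _ hB' hC, h₁₂ _ _ hA hB, mul_assoc]

section

variable {Ω : Type*}

/-- The σ-algebra generated by all variables except the relative sizes of the children of `u`. -/
@[reducible]
def offSigma (ξ : Node → Ω → ℕ → ℝ) (e : Node → Ω → ℝ) (u : Node) : MeasurableSpace Ω :=
  (⨆ v ∈ {v | v ≠ u}, MeasurableSpace.comap (ξ v) inferInstance) ⊔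
    ⨆ v, MeasurableSpace.comap (e v) inferInstance

/-- The `p`-th power of the size of the node `u` of the marked tree. -/
def nodeWeight (α : ℝ) (ξ : Node → Ω → ℕ → ℝ) (e : Node → Ω → ℝ) (s p : ℝ) (u : Node) (ω : Ω) :
    ℝ≥0∞ :=
  ENNReal.ofReal ((markedTree α ξ e s ω u).1 ^ p)

variable {α : ℝ} {ξ : Node → Ω → ℕ → ℝ} {e : Node → Ω → ℝ} {s : ℝ}

theorem preSigma_le_offSigma {L : Set Node} {v : Node}
    (h : ∀ i, ∀ l ∈ L, ¬ (v ++ [i]) <+: l) : preSigma ξ e L ≤ offSigma ξ e v := by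
  refine sup_le_sup (iSup_le fun u => iSup_le fun i => iSup_le fun ⟨l, hl, hul⟩ => ?_)
    (iSup_le fun u => iSup_le fun _ => le_iSup (fun v => MeasurableSpace.comap (e v) _) u)
  have hu : u ≠ v := fun huv => h i l hl (huv ▸ hul)
  refine le_trans ?_ (le_iSup₂ (f := fun (v' : Node) (_ : v' ∈ {v' | v' ≠ v}) =>
    MeasurableSpace.comap (ξ v') inferInstance) u hu)
  exact Measurable.comap_le ((measurable_pi_apply i).comp (comap_measurable (ξ u)))

/-- No node of a line `L` lies strictly below another one, so `preSigma ξ e L` never sees the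
offspring of a node stemming from `L`. -/
theorem IsLine.preSigma_le_offSigma {L : Set Node} (hL : IsLine L) {l : Node} (hl : l ∈ L)
    (w : Node) : preSigma ξ e L ≤ offSigma ξ e (l ++ w) := by
  refine _root_.preSigma_le_offSigma fun i l' hl' h => ?_
  obtain rfl := hL l hl l' hl' ((List.prefix_append l w).trans ((List.prefix_append _ _).trans h))
  have := h.length_le
  simp at this

theorem preSigma_mono {L Q : Set Node} (h : ∀ l ∈ L, ∃ q ∈ Q, l <+: q) :
    preSigma ξ e L ≤ preSigma ξ e Q := by
  refine sup_le_sup ?_ ?_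
  · refine iSup_le fun u => iSup_le fun i => iSup_le fun ⟨l, hl, hul⟩ => ?_
    obtain ⟨q, hq, hlq⟩ := h l hl
    exact le_iSup_of_le u (le_iSup_of_le i (le_iSup_of_le ⟨q, hq, hul.trans hlq⟩ le_rfl))
  · refine iSup_le fun u => iSup_le fun ⟨l, hl, hul⟩ => ?_
    obtain ⟨q, hq, hlq⟩ := h l hl
    exact le_iSup_of_le u (le_iSup_of_le ⟨q, hq, hul.trans hlq⟩ le_rfl)

theorem markedTree_child_size (ω : Ω) (u : Node) (i : ℕ) :
    (markedTree α ξ e s ω (u ++ [i])).1 = ξ u ω i * (markedTree α ξ e s ω u).1 := by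
  rw [markedTree_child]; rfl

theorem measurable_size {m : MeasurableSpace Ω} (u : Node)
    (h : ∀ v i, (v ++ [i]) <+: u → Measurable[m] fun ω => ξ v ω i) :
    Measurable[m] fun ω => (markedTree α ξ e s ω u).1 := by
  induction u using List.reverseRecOn with
  | nil => exact measurable_const
  | append_singleton u i ih =>
    simp only [markedTree_child_size]
    exact (h u i List.prefix_rfl).mul (ih fun v j hv => h v j (hv.trans (List.prefix_append _ _)))

theorem measurable_preSigma {L : Set Node} {u : Node} {i : ℕ}
    (h : ∃ l ∈ L, (u ++ [i]) <+: l) : Measurable[preSigma ξ e L] fun ω => ξ u ω i :=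
  Measurable.of_comap_le (le_sup_of_le_left
    (le_iSup_of_le u (le_iSup_of_le i (le_iSup_of_le h le_rfl))))

theorem measurable_nodeWeight_preSigma {L : Set Node} {u : Node} (h : ∃ l ∈ L, u <+: l) (p : ℝ) :
    Measurable[preSigma ξ e L] (nodeWeight α ξ e s p u) := by
  obtain ⟨l, hl, hul⟩ := h
  refine ENNReal.measurable_ofReal.comp (Measurable.pow_const ?_ p)
  exact measurable_size u fun v i hv => measurable_preSigma ⟨l, hl, hv.trans hul⟩

theorem intrinsicSum_eq (p : ℝ) (Q : Set Node) (ω : Ω) :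
    intrinsicSum p Q (markedTree α ξ e s ω) = ∑' u : Q, nodeWeight α ξ e s p u ω := rfl

theorem measurable_intrinsicSum_preSigma (p : ℝ) (Q : Set Node) :
    Measurable[preSigma ξ e Q] fun ω => intrinsicSum p Q (markedTree α ξ e s ω) :=
  measurable_ennreal_tsum fun u =>
    measurable_nodeWeight_preSigma ⟨u, u.2, List.prefix_rfl⟩ p

theorem measurable_nodeWeight_offSigma (p : ℝ) {u v : Node} (huv : ∀ i, ¬ (v ++ [i]) <+: u) :
    Measurable[offSigma ξ e v] (nodeWeight α ξ e s p u) :=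
  (measurable_nodeWeight_preSigma (L := {u}) ⟨u, rfl, List.prefix_rfl⟩ p).mono
    (preSigma_le_offSigma fun i l hl => by rw [Set.mem_singleton_iff.1 hl]; exact huv i) le_rfl

variable [MeasurableSpace Ω] {P : Measure Ω} {ν : Measure FinitePointMeasure}

namespace IsReproductionFamily

variable (h : IsReproductionFamily P ν ξ e)
include h

theorem preSigma_le (L : Set Node) : preSigma ξ e L ≤ ‹MeasurableSpace Ω› :=
  sup_le
    (iSup_le fun u => iSup_le fun i => iSup_le fun _ =>
      ((measurable_pi_apply i).comp (h.measurable_size u)).comap_le)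
    (iSup_le fun u => iSup_le fun _ => (h.measurable_exp u).comap_le)

theorem offSigma_le (u : Node) : offSigma ξ e u ≤ ‹MeasurableSpace Ω› :=
  sup_le (iSup₂_le fun v _ => (h.measurable_size v).comap_le)
    (iSup_le fun v => (h.measurable_exp v).comap_le)

theorem indep_offSigma [IsProbabilityMeasure P] (u : Node) :
    Indep (MeasurableSpace.comap (ξ u) inferInstance) (offSigma ξ e u) P := by
  refine indep_sup_right (h.measurable_size u).comap_le
    (iSup₂_le fun v _ => (h.measurable_size v).comap_le)
    (iSup_le fun v => (h.measurable_exp v).comap_le) ?_ ?_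
  · have := indep_iSup_of_disjoint (fun v => (h.measurable_size v).comap_le) h.size_indep
      (S := {u}) (T := {v | v ≠ u}) (by simp)
    simpa using this
  · refine indep_of_indep_of_le_left (indep_of_indep_of_le_right h.indep ?_) ?_
    · exact iSup_le fun v => Measurable.comap_le
        ((measurable_pi_apply v).comp (comap_measurable fun ω u => e u ω))
    · refine sup_le ?_ (iSup₂_le fun v _ => ?_)
      · exact Measurable.comap_le ((measurable_pi_apply u).comp (comap_measurable fun ω u => ξ u ω))
      · exact Measurable.comap_le ((measurable_pi_apply v).comp (comap_measurable fun ω u => ξ u ω))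

theorem lintegral_mul_offSigma [IsProbabilityMeasure P] (u : Node) {φ : (ℕ → ℝ) → ℝ≥0∞}
    (hφ : Measurable φ) {f : Ω → ℝ≥0∞} (hf : Measurable[offSigma ξ e u] f) :
    ∫⁻ ω, φ (ξ u ω) * f ω ∂P = (∫⁻ ω, φ (ξ [] ω) ∂P) * ∫⁻ ω, f ω ∂P := by
  refine (lintegral_mul_eq_lintegral_mul_lintegral_of_independent_measurableSpace
    (h.measurable_size u).comap_le (h.offSigma_le u) (h.indep_offSigma u)
    (hφ.comp (comap_measurable (ξ u))) hf).trans ?_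
  congr 1
  exact ((h.size_identDistrib u []).comp hφ).lintegral_eq

theorem measurable_nodeWeight (p : ℝ) (u : Node) : Measurable (nodeWeight α ξ e s p u) :=
  (measurable_nodeWeight_preSigma (L := {u}) ⟨u, rfl, List.prefix_rfl⟩ p).mono
    (h.preSigma_le _) le_rfl

theorem ae_nonneg : ∀ᵐ ω ∂P, ∀ u i, 0 ≤ ξ u ω i :=
  ae_all_iff.2 fun u => (h.size_law u).ae_nonneg

theorem ae_size_nonneg (hs : 0 ≤ s) : ∀ᵐ ω ∂P, ∀ u, 0 ≤ (markedTree α ξ e s ω u).1 := by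
  filter_upwards [h.ae_nonneg] with ω hω u
  induction u using List.reverseRecOn with
  | nil => exact hs
  | append_singleton u j ih =>
    rw [markedTree_child_size]
    exact mul_nonneg (hω u j) ih

theorem ae_nodeWeight_child (hs : 0 ≤ s) (p : ℝ) : ∀ᵐ ω ∂P, ∀ u i,
    nodeWeight α ξ e s p (u ++ [i]) ω = ENNReal.ofReal (ξ u ω i ^ p) * nodeWeight α ξ e s p u ω := by
  filter_upwards [h.ae_nonneg, h.ae_size_nonneg (α := α) hs] with ω hω hnn u i
  unfold nodeWeight
  rw [markedTree_child_size, Real.mul_rpow (hω u i) (hnn u),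
    ENNReal.ofReal_mul (Real.rpow_nonneg (hω u i) p)]

/-! ### First moments along lines. -/

theorem tsum_meanWeight {p : ℝ} (hp : p ≠ 0) :
    ∑' i, ∫⁻ ω, ENNReal.ofReal (ξ [] ω i ^ p) ∂P = reproMoment ν p := by
  have hmeas := h.measurable_size []
  rw [← lintegral_tsum fun i => by fun_prop]
  exact (h.size_law []).lintegral_comp_tsum hp measurable_id

/-- The last letter of the path is removed at each step: its relative size is independent of both
`A` and the weight of the parent, as these are measurable for `offSigma` at the parent. -/
theorem setLIntegral_nodeWeight_append [IsProbabilityMeasure P] (hs : 0 ≤ s) (p : ℝ)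
    {L : Set Node} (hL : IsLine L) {l : Node} (hl : l ∈ L) {A : Set Ω}
    (hA : MeasurableSet[preSigma ξ e L] A) (w : Node) :
    ∫⁻ ω in A, nodeWeight α ξ e s p (l ++ w) ω ∂P =
      (w.map fun i => ∫⁻ ω, ENNReal.ofReal (ξ [] ω i ^ p) ∂P).prod *
        ∫⁻ ω in A, nodeWeight α ξ e s p l ω ∂P := by
  have hA' := h.preSigma_le L A hA
  induction w using List.reverseRecOn with
  | nil => simp
  | append_singleton w i ih =>
    rw [List.map_append, List.prod_append, mul_right_comm, ← ih, List.map_singleton,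
      List.prod_singleton, mul_comm, ← lintegral_indicator hA', ← lintegral_indicator hA',
      ← h.lintegral_mul_offSigma (l ++ w) (φ := fun x => ENNReal.ofReal (x i ^ p)) (by fun_prop)]
    · refine lintegral_congr_ae ?_
      filter_upwards [h.ae_nodeWeight_child (α := α) hs p] with ω hω
      by_cases hωA : ω ∈ A
      · simp only [Set.indicator_of_mem hωA]
        rw [← List.append_assoc, hω]
      · simp [hωA]
    · exact (measurable_nodeWeight_offSigma p fun i hi => by
        have := hi.length_le; simp at this).indicator (hL.preSigma_le_offSigma hl w A hA)

theorem setLIntegral_intrinsicSum_self (p : ℝ) (L : Set Node) (A : Set Ω) :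
    ∫⁻ ω in A, intrinsicSum p L (markedTree α ξ e s ω) ∂P =
      ∑' l : L, ∫⁻ ω in A, nodeWeight α ξ e s p l ω ∂P := by
  simp only [intrinsicSum_eq]
  exact lintegral_tsum fun l : L => (h.measurable_nodeWeight p (l : Node)).aemeasurable

theorem setLIntegral_intrinsicSum [IsProbabilityMeasure P] (hs : 0 ≤ s) (p : ℝ)
    {L Q : Set Node} (hL : IsLine L) (hLQ : Precedes L Q) {A : Set Ω}
    (hA : MeasurableSet[preSigma ξ e L] A) :
    ∫⁻ ω in A, intrinsicSum p Q (markedTree α ξ e s ω) ∂P =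
      ∑' l : L, (∑' w : wordsFrom (l : Node) Q,
        ((w : Node).map fun i => ∫⁻ ω, ENNReal.ofReal (ξ [] ω i ^ p) ∂P).prod) *
          ∫⁻ ω in A, nodeWeight α ξ e s p l ω ∂P := by
  rw [h.setLIntegral_intrinsicSum_self,
    ← (lineEquiv hL hLQ).tsum_eq, ENNReal.tsum_sigma']
  refine tsum_congr fun l => ?_
  rw [← ENNReal.tsum_mul_right]
  exact tsum_congr fun w => h.setLIntegral_nodeWeight_append hs p hL l.2 hA w

variable {p₀ : ℝ}

theorem setLIntegral_intrinsicSum_le [IsProbabilityMeasure P] [IsProbabilityMeasure ν]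
    (hν : MalthusianHypotheses ν p₀) (hs : 0 ≤ s) {L Q : Set Node} (hL : IsLine L) (hQ : IsLine Q)
    (hLQ : Precedes L Q) {A : Set Ω} (hA : MeasurableSet[preSigma ξ e L] A) :
    ∫⁻ ω in A, intrinsicSum p₀ Q (markedTree α ξ e s ω) ∂P ≤
      ∫⁻ ω in A, intrinsicSum p₀ L (markedTree α ξ e s ω) ∂P := by
  rw [h.setLIntegral_intrinsicSum hs p₀ hL hLQ hA, h.setLIntegral_intrinsicSum_self]
  refine ENNReal.tsum_le_tsum fun l => mul_le_of_le_one_left' ?_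
  exact tsum_line_le_one
    ((h.tsum_meanWeight hν.pos.ne').trans hν.reproMoment_eq_one).le (hQ.wordsFrom _)

theorem setLIntegral_intrinsicSum_eq [IsProbabilityMeasure P] [IsProbabilityMeasure ν]
    (hν : MalthusianHypotheses ν p₀) (hs : 0 ≤ s) {L Q : Set Node} (hL : IsLine L) (hQ : IsLine Q)
    (hfin : maxGeneration Q < ⊤) (hLQ : Covers Q L) {A : Set Ω}
    (hA : MeasurableSet[preSigma ξ e L] A) :
    ∫⁻ ω in A, intrinsicSum p₀ Q (markedTree α ξ e s ω) ∂P =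
      ∫⁻ ω in A, intrinsicSum p₀ L (markedTree α ξ e s ω) ∂P := by
  obtain ⟨n, hn⟩ := exists_length_le_of_maxGeneration_lt_top hfin
  rw [h.setLIntegral_intrinsicSum hs p₀ hL hLQ.1 hA, h.setLIntegral_intrinsicSum_self]
  refine tsum_congr fun l => ?_
  rw [tsum_line_eq_one ((h.tsum_meanWeight hν.pos.ne').trans hν.reproMoment_eq_one) n
    (hQ.wordsFrom _) (fun w hw => le_trans (by simp) (hn _ hw))
    (hLQ.coversRoot_wordsFrom hL l.2), one_mul]

end IsReproductionFamily

end

/-! ### Moments of order `1 + r` of the intrinsic martingale -/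

/-- Weighted AM-GM for `x ^ (1 + r)` and `x ^ r * y`, where the exponent of `x` in the geometric
mean is `(1 + r) * (1 - r) + r * r = 1`. It plays the role of the conditional Jensen inequality in
the moment bound. -/
theorem ENNReal.mul_rpow_le_convex {r : ℝ} (h₀ : 0 < r) (h₁ : r < 1) (x y : ℝ≥0∞) :
    x * y ^ r ≤ ENNReal.ofReal (1 - r) * x ^ (1 + r) + ENNReal.ofReal r * (x ^ r * y) := by
  have hr : ENNReal.ofReal r ≠ 0 := (ENNReal.ofReal_pos.2 h₀).ne'
  have hr' : ENNReal.ofReal (1 - r) ≠ 0 := (ENNReal.ofReal_pos.2 (sub_pos.2 h₁)).ne'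
  rcases eq_or_ne x ⊤ with rfl | hx
  · rw [ENNReal.top_rpow_of_pos (by linarith), ENNReal.mul_top hr']
    simp
  rcases eq_or_ne y ⊤ with rfl | hy
  · rcases eq_or_ne x 0 with rfl | hx0
    · simp
    · have : x ^ r ≠ 0 := by simp [ENNReal.rpow_eq_zero_iff, hx0, hx]
      rw [ENNReal.mul_top this, ENNReal.mul_top hr]
      simp
  lift x to NNReal using hx
  lift y to NNReal using hy
  have hx0 : (0 : ℝ) ≤ x := x.2
  have hy0 : (0 : ℝ) ≤ y := y.2
  have key : (x : ℝ) * (y : ℝ) ^ r ≤ (1 - r) * (x : ℝ) ^ (1 + r) + r * ((x : ℝ) ^ r * y) := by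
    refine le_trans (le_of_eq ?_) (Real.geom_mean_le_arith_mean2_weighted (sub_pos.2 h₁).le h₀.le
      (Real.rpow_nonneg hx0 _) (mul_nonneg (Real.rpow_nonneg hx0 _) hy0) (by ring))
    rw [Real.mul_rpow (Real.rpow_nonneg hx0 _) hy0, ← Real.rpow_mul hx0, ← Real.rpow_mul hx0,
      ← mul_assoc, ← Real.rpow_add_of_nonneg hx0 (mul_nonneg (by linarith) (by linarith))
        (mul_nonneg h₀.le h₀.le)]
    rw [show (1 + r) * (1 - r) + r * r = 1 by ring, Real.rpow_one]
  rw [← ENNReal.ofReal_coe_nnreal, ← ENNReal.ofReal_coe_nnreal (p := y),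
    ENNReal.ofReal_rpow_of_nonneg hy0 h₀.le, ENNReal.ofReal_rpow_of_nonneg hx0 h₀.le,
    ENNReal.ofReal_rpow_of_nonneg hx0 (by linarith), ← ENNReal.ofReal_mul hx0,
    ← ENNReal.ofReal_mul (Real.rpow_nonneg hx0 _), ← ENNReal.ofReal_mul h₀.le,
    ← ENNReal.ofReal_mul (sub_pos.2 h₁).le, ← ENNReal.ofReal_add (by
      have := sub_pos.2 h₁; positivity) (by positivity)]
  exact ENNReal.ofReal_le_ofReal key

theorem ENNReal.rpow_one_add {r : ℝ} (hr : 0 ≤ r) (x : ℝ≥0∞) : x ^ (1 + r) = x * x ^ r := by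
  rw [ENNReal.rpow_add_of_nonneg 1 r zero_le_one hr, ENNReal.rpow_one]

/-- The sum of a family from which the index `j` is omitted. -/
def tsumExcept {ι : Type*} [DecidableEq ι] (f : ι → ℝ≥0∞) (j : ι) : ℝ≥0∞ :=
  ∑' i, if i = j then 0 else f i

theorem tsumExcept_le {ι : Type*} [DecidableEq ι] (f : ι → ℝ≥0∞) (j : ι) :
    tsumExcept f j ≤ ∑' i, f i :=
  ENNReal.tsum_le_tsum fun i => by split_ifs <;> simp

/-- One factor of the sum is expanded over `j`, and `t ^ r` is subadditive. Each cross term then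
keeps `f j` apart from the other summands. -/
theorem tsum_rpow_one_add_le {ι : Type*} [DecidableEq ι] {r : ℝ} (h₀ : 0 ≤ r) (h₁ : r ≤ 1)
    (f : ι → ℝ≥0∞) :
    (∑' j, f j) ^ (1 + r) ≤ ∑' j, (f j ^ (1 + r) + f j * tsumExcept f j ^ r) := by
  rw [ENNReal.rpow_one_add h₀, ← ENNReal.tsum_mul_right]
  refine ENNReal.tsum_le_tsum fun j => ?_
  have hsplit : ∑' i, f i = f j + tsumExcept f j := by
    rw [ENNReal.tsum_eq_add_tsum_ite j, tsumExcept]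
    congr!
  rw [ENNReal.rpow_one_add h₀, ← mul_add, hsplit]
  gcongr
  exact ENNReal.rpow_add_le_add_rpow _ _ h₀ h₁

theorem tsum_generation_succ (f : Node → ℝ≥0∞) (n : ℕ) :
    ∑' v : generation (n + 1), f v = ∑' (u : generation n) (i : ℕ), f ((u : Node) ++ [i]) := by
  rw [← (generationSuccEquiv n).tsum_eq, ← ENNReal.tsum_prod]
  rfl

theorem tsum_generation_prod (m : ℕ → ℝ≥0∞) (n : ℕ) :
    ∑' w : generation n, ((w : Node).map m).prod = (∑' i, m i) ^ n := by
  induction n with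
  | zero =>
    exact (tsum_line_eq_one_of_nil_mem (isLine_generation 0) rfl m).trans (pow_zero _).symm
  | succ n ih =>
    rw [tsum_generation_succ fun w => (w.map m).prod, pow_succ, ← ih, ← ENNReal.tsum_mul_right]
    refine tsum_congr fun w => ?_
    rw [← ENNReal.tsum_mul_left]
    refine tsum_congr fun i => ?_
    simp

section

variable {Ω : Type*} [MeasurableSpace Ω] {P : Measure Ω}

/-- A family that is bounded in a moment of order `1 + r` is uniformly integrable. -/
theorem uniformIntegrable_toReal_of_lintegral_rpow_le [IsFiniteMeasure P] {ι : Type*}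
    {f : ι → Ω → ℝ≥0∞} (hf : ∀ i, Measurable (f i)) {r : ℝ} (hr : 0 < r) {K : ℝ≥0∞} (hK : K ≠ ⊤)
    (h : ∀ i, ∫⁻ ω, f i ω ^ (1 + r) ∂P ≤ K) :
    UniformIntegrable (fun i ω => (f i ω).toReal) 1 P := by
  refine uniformIntegrable_of le_rfl ENNReal.one_ne_top
    (fun i => (hf i).ennreal_toReal.aestronglyMeasurable) fun ε hε => ?_
  have hε' : ENNReal.ofReal ε ≠ 0 := (ENNReal.ofReal_pos.2 hε).ne'
  -- With `D` this number, `D * f ≤ f ^ (1 + r)` wherever `f ≥ D ^ r⁻¹`, so the tail integral is at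
  -- most `K / D ≤ ε`. The added `1` keeps `D` nonzero when `K = 0`.
  have hD : K / ENNReal.ofReal ε + 1 ≠ ⊤ :=
    ENNReal.add_ne_top.2 ⟨ENNReal.div_ne_top hK hε', ENNReal.one_ne_top⟩
  set D := K / ENNReal.ofReal ε + 1 with hDdef
  refine ⟨(D ^ r⁻¹).toNNReal, fun i => ?_⟩
  have hCtop : D ^ r⁻¹ ≠ ⊤ := ENNReal.rpow_ne_top_of_nonneg (inv_nonneg.2 hr.le) hD
  have hle : eLpNorm ({x | (D ^ r⁻¹).toNNReal ≤ ‖(f i x).toReal‖₊}.indicator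
      fun ω => (f i ω).toReal) 1 P * D ≤ K := by
    rw [eLpNorm_one_eq_lintegral_enorm, ← lintegral_mul_const' _ _ hD]
    refine le_trans (lintegral_mono fun ω => ?_) (h i)
    by_cases hω : (D ^ r⁻¹).toNNReal ≤ ‖(f i ω).toReal‖₊
    · rw [Set.indicator_of_mem (by exact hω)]
      have h1 : ‖(f i ω).toReal‖ₑ ≤ f i ω := by
        rw [Real.enorm_of_nonneg ENNReal.toReal_nonneg]
        exact ENNReal.ofReal_toReal_le
      have h2 : D ^ r⁻¹ ≤ f i ω := by
        refine le_trans ?_ h1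
        rw [← ENNReal.coe_toNNReal hCtop, enorm_eq_nnnorm]
        exact_mod_cast hω
      have h3 : D ≤ f i ω ^ r := by
        have := ENNReal.rpow_le_rpow h2 hr.le
        rwa [ENNReal.rpow_inv_rpow hr.ne'] at this
      rw [ENNReal.rpow_one_add hr.le]
      exact mul_le_mul' h1 h3
    · rw [Set.indicator_of_notMem (by exact hω)]
      simp
  have hD0 : D ≠ 0 := by simp [hDdef]
  refine le_trans ((ENNReal.le_div_iff_mul_le (Or.inl hD0) (Or.inl hD)).2 hle) ?_
  rw [ENNReal.div_le_iff hD0 hD, hDdef, mul_add, ENNReal.mul_div_cancel hε' ENNReal.ofReal_ne_top]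
  exact le_self_add

end

section

variable {Ω : Type*} {α : ℝ} {ξ : Node → Ω → ℕ → ℝ} {e : Node → Ω → ℝ} {s : ℝ}

/-- The sum of the `p`-th powers of the relative sizes of the children of `u`. -/
def childSum (ξ : Node → Ω → ℕ → ℝ) (p : ℝ) (u : Node) (ω : Ω) : ℝ≥0∞ :=
  ∑' i, ENNReal.ofReal (ξ u ω i ^ p)

theorem measurable_childSum_offSigma (p : ℝ) {u v : Node} (huv : u ≠ v) :
    Measurable[offSigma ξ e v] (childSum ξ p u) := by
  have h : Measurable[offSigma ξ e v] (ξ u) :=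
    Measurable.of_comap_le (le_sup_of_le_left (le_iSup₂_of_le u huv le_rfl))
  refine measurable_ennreal_tsum fun i => ENNReal.measurable_ofReal.comp (Measurable.pow_const ?_ p)
  exact (measurable_pi_apply i).comp h

theorem measurable_nodeWeight_offSigma_of_generation (p : ℝ) {n : ℕ} (u v : generation n) :
    Measurable[offSigma ξ e v] (nodeWeight α ξ e s p (u : Node)) := by
  refine measurable_nodeWeight_offSigma p fun i hi => ?_
  have h := hi.length_le
  have hu : (u : Node).length = n := u.2
  have hv : (v : Node).length = n := v.2
  simp [hu, hv] at h

variable [MeasurableSpace Ω] {P : Measure Ω} {ν : Measure FinitePointMeasure}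

namespace IsReproductionFamily

variable (h : IsReproductionFamily P ν ξ e)
include h

theorem measurable_childSum (p : ℝ) (u : Node) : Measurable (childSum ξ p u) := by
  have := h.measurable_size u
  exact measurable_ennreal_tsum fun i => by fun_prop

theorem measurable_intrinsicSum (p : ℝ) (Q : Set Node) :
    Measurable fun ω => intrinsicSum p Q (markedTree α ξ e s ω) :=
  (measurable_intrinsicSum_preSigma p Q).mono (h.preSigma_le Q) le_rfl

theorem lintegral_childSum_comp_mul [IsProbabilityMeasure P] {p : ℝ} (hp : p ≠ 0) (u : Node)
    {φ : ℝ≥0∞ → ℝ≥0∞} (hφ : Measurable φ) {f : Ω → ℝ≥0∞} (hf : Measurable[offSigma ξ e u] f) :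
    ∫⁻ ω, φ (childSum ξ p u ω) * f ω ∂P = (∫⁻ t, φ (powerSum p t) ∂ν) * ∫⁻ ω, f ω ∂P := by
  rw [← (h.size_law []).lintegral_comp_tsum hp hφ]
  refine h.lintegral_mul_offSigma u (φ := fun x => φ (∑' i, ENNReal.ofReal (x i ^ p)))
    (hφ.comp (measurable_ennreal_tsum fun i => by fun_prop)) hf

theorem ae_intrinsicSum_generation_succ (hs : 0 ≤ s) (p : ℝ) (n : ℕ) : ∀ᵐ ω ∂P,
    intrinsicSum p (generation (n + 1)) (markedTree α ξ e s ω) =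
      ∑' u : generation n, childSum ξ p u ω * nodeWeight α ξ e s p u ω := by
  filter_upwards [h.ae_nodeWeight_child (α := α) hs p] with ω hω
  rw [intrinsicSum_eq, tsum_generation_succ fun u => nodeWeight α ξ e s p u ω]
  refine tsum_congr fun u => ?_
  rw [childSum, ← ENNReal.tsum_mul_right]
  exact tsum_congr fun i => hω u i

theorem ae_nodeWeight_rpow (hs : 0 ≤ s) (p : ℝ) {q : ℝ} (hq : 0 ≤ q) : ∀ᵐ ω ∂P, ∀ u,
    nodeWeight α ξ e s p u ω ^ q = nodeWeight α ξ e s (p * q) u ω := by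
  filter_upwards [h.ae_size_nonneg (α := α) hs] with ω hω u
  rw [nodeWeight, nodeWeight, ENNReal.ofReal_rpow_of_nonneg (Real.rpow_nonneg (hω u) _) hq,
    Real.rpow_mul (hω u)]

theorem tsum_lintegral_nodeWeight_generation [IsProbabilityMeasure P] (hs : 0 ≤ s) {p : ℝ}
    (hp : p ≠ 0) (n : ℕ) :
    ∑' u : generation n, ∫⁻ ω, nodeWeight α ξ e s p u ω ∂P =
      reproMoment ν p ^ n * ENNReal.ofReal (s ^ p) := by
  rw [← h.tsum_meanWeight hp, ← tsum_generation_prod, ← ENNReal.tsum_mul_right]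
  refine tsum_congr fun u => ?_
  have := h.setLIntegral_nodeWeight_append (α := α) hs p (L := {[]}) (l := [])
    (by rintro _ rfl _ rfl _; rfl) rfl (A := Set.univ) MeasurableSet.univ u
  rw [Measure.restrict_univ] at this
  refine this.trans ?_
  congr 1
  simp [nodeWeight, markedTree_root, mkMark]

/-- With weights `Z u` and offspring sums `Y u` of mean one, the next generation has total `S = ∑ Y
u * Z u`. The diagonal terms of `tsum_rpow_one_add_le` give the additive error; the cross terms sum
to at most the mean of `M * S ^ r`, hence to at most the previous moment. -/
theorem lintegral_intrinsicSum_rpow_succ_le [IsProbabilityMeasure P] (hs : 0 ≤ s) {p : ℝ}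
    (hp : p ≠ 0) (hmean : reproMoment ν p = 1) {r : ℝ} (h₀ : 0 < r) (h₁ : r < 1) (n : ℕ) :
    ∫⁻ ω, intrinsicSum p (generation (n + 1)) (markedTree α ξ e s ω) ^ (1 + r) ∂P ≤
      ∫⁻ ω, intrinsicSum p (generation n) (markedTree α ξ e s ω) ^ (1 + r) ∂P +
        (∫⁻ t, powerSum p t ^ (1 + r) ∂ν) *
          ∑' u : generation n, ∫⁻ ω, nodeWeight α ξ e s p u ω ^ (1 + r) ∂P := by
  classical
  have hr1 : 0 ≤ 1 + r := by linarith
  set Z : generation n → Ω → ℝ≥0∞ := fun u => nodeWeight α ξ e s p u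
  set Y : generation n → Ω → ℝ≥0∞ := fun u => childSum ξ p u
  set M : Ω → ℝ≥0∞ := fun ω => ∑' u, Z u ω
  set S : Ω → ℝ≥0∞ := fun ω => ∑' u, Y u ω * Z u ω
  have hZ : ∀ u, Measurable (Z u) := fun u => h.measurable_nodeWeight p u
  have hY : ∀ u, Measurable (Y u) := fun u => h.measurable_childSum p u
  have hZo : ∀ u v : generation n, Measurable[offSigma ξ e v] (Z u) :=
    measurable_nodeWeight_offSigma_of_generation p
  have hM : Measurable M := measurable_ennreal_tsum hZ
  have hMo : ∀ v : generation n, Measurable[offSigma ξ e v] M := fun v =>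
    measurable_ennreal_tsum fun u => hZo u v
  have hS : Measurable S := measurable_ennreal_tsum fun u => (hY u).mul (hZ u)
  have hmul : ∀ (u : generation n) {f : Ω → ℝ≥0∞}, Measurable[offSigma ξ e u] f →
      ∫⁻ ω, Y u ω * f ω ∂P = ∫⁻ ω, f ω ∂P := fun u f hf => by
    refine (h.lintegral_childSum_comp_mul hp u measurable_id hf).trans ?_
    exact (congrArg (· * ∫⁻ ω, f ω ∂P) hmean).trans (one_mul _)
  -- Omitting the index `u` makes the rest independent of `Y u`.
  have hRo : ∀ u : generation n,
      Measurable[offSigma ξ e u] fun ω => tsumExcept (fun v => Y v ω * Z v ω) u := fun u => by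
    refine measurable_ennreal_tsum fun v => ?_
    by_cases hvu : v = u
    · simp [hvu]
    · simp only [if_neg hvu]
      exact (measurable_childSum_offSigma p fun heq => hvu (Subtype.ext heq)).mul (hZo v u)
  have hMS : ∫⁻ ω, M ω ^ r * S ω ∂P = ∫⁻ ω, M ω ^ (1 + r) ∂P := by
    calc ∫⁻ ω, M ω ^ r * S ω ∂P = ∫⁻ ω, ∑' u, Y u ω * (Z u ω * M ω ^ r) ∂P := by
          refine lintegral_congr fun ω => ?_
          rw [mul_comm, ← ENNReal.tsum_mul_right]
          exact tsum_congr fun u => mul_assoc _ _ _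
      _ = ∑' u, ∫⁻ ω, Y u ω * (Z u ω * M ω ^ r) ∂P :=
          lintegral_tsum fun u => ((hY u).mul ((hZ u).mul (hM.pow_const r))).aemeasurable
      _ = ∑' u, ∫⁻ ω, Z u ω * M ω ^ r ∂P :=
          tsum_congr fun u => hmul u ((hZo u u).mul ((hMo u).pow_const r))
      _ = ∫⁻ ω, ∑' u, Z u ω * M ω ^ r ∂P :=
          (lintegral_tsum fun u => ((hZ u).mul (hM.pow_const r)).aemeasurable).symm
      _ = ∫⁻ ω, M ω ^ (1 + r) ∂P := by
          refine lintegral_congr fun ω => ?_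
          rw [ENNReal.tsum_mul_right, ENNReal.rpow_one_add h₀.le]
  have hfirst : ∀ u, ∫⁻ ω, (Y u ω * Z u ω) ^ (1 + r) ∂P =
      (∫⁻ t, powerSum p t ^ (1 + r) ∂ν) * ∫⁻ ω, Z u ω ^ (1 + r) ∂P := fun u => by
    simp only [ENNReal.mul_rpow_of_nonneg _ _ hr1]
    exact h.lintegral_childSum_comp_mul hp u (φ := fun x => x ^ (1 + r)) (by fun_prop)
      ((hZo u u).pow_const _)
  -- Once the factor `Y u` is integrated out, the omitted term may be restored.
  have hsecond : ∀ u, ∫⁻ ω, Y u ω * Z u ω * tsumExcept (fun v => Y v ω * Z v ω) u ^ r ∂P ≤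
      ∫⁻ ω, Z u ω * S ω ^ r ∂P := fun u => by
    simp only [mul_assoc]
    refine (hmul u (f := fun ω => Z u ω * tsumExcept (fun v => Y v ω * Z v ω) u ^ r)
      ((hZo u u).mul ((hRo u).pow_const r))).trans_le ?_
    exact lintegral_mono fun ω =>
      mul_le_mul_right (ENNReal.rpow_le_rpow (tsumExcept_le _ u) h₀.le) _
  have hgrow : ∑' u, ∫⁻ ω, Z u ω * S ω ^ r ∂P ≤ ∫⁻ ω, M ω ^ (1 + r) ∂P := by
    calc ∑' u, ∫⁻ ω, Z u ω * S ω ^ r ∂P = ∫⁻ ω, ∑' u, Z u ω * S ω ^ r ∂P :=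
          (lintegral_tsum fun u => ((hZ u).mul (hS.pow_const r)).aemeasurable).symm
      _ ≤ ∫⁻ ω, (ENNReal.ofReal (1 - r) * M ω ^ (1 + r) +
            ENNReal.ofReal r * (M ω ^ r * S ω)) ∂P := by
          refine lintegral_mono fun ω => ?_
          simp only [ENNReal.tsum_mul_right]
          exact ENNReal.mul_rpow_le_convex h₀ h₁ _ _
      _ = ENNReal.ofReal (1 - r) * ∫⁻ ω, M ω ^ (1 + r) ∂P +
            ENNReal.ofReal r * ∫⁻ ω, M ω ^ (1 + r) ∂P := by
          rw [lintegral_add_left ((hM.pow_const _).const_mul _),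
            lintegral_const_mul _ (hM.pow_const _),
            lintegral_const_mul (f := fun ω => M ω ^ r * S ω) _ ((hM.pow_const _).mul hS), hMS]
      _ = ∫⁻ ω, M ω ^ (1 + r) ∂P := by
          rw [← add_mul, ← ENNReal.ofReal_add (sub_pos.2 h₁).le h₀.le]
          simp
  calc ∫⁻ ω, intrinsicSum p (generation (n + 1)) (markedTree α ξ e s ω) ^ (1 + r) ∂P
      = ∫⁻ ω, S ω ^ (1 + r) ∂P := by
        refine lintegral_congr_ae ?_
        filter_upwards [h.ae_intrinsicSum_generation_succ (α := α) hs p n] with ω hω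
        rw [hω]
    _ ≤ ∫⁻ ω, ∑' u, ((Y u ω * Z u ω) ^ (1 + r) +
          Y u ω * Z u ω * tsumExcept (fun v => Y v ω * Z v ω) u ^ r) ∂P :=
        lintegral_mono fun ω => tsum_rpow_one_add_le h₀.le h₁.le _
    _ = ∑' u, (∫⁻ ω, (Y u ω * Z u ω) ^ (1 + r) ∂P +
          ∫⁻ ω, Y u ω * Z u ω * tsumExcept (fun v => Y v ω * Z v ω) u ^ r ∂P) := by
        have hR : ∀ u : generation n,
            Measurable fun ω => tsumExcept (fun v => Y v ω * Z v ω) u := fun u =>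
          (hRo u).mono (h.offSigma_le u) le_rfl
        refine (lintegral_tsum fun u => ((((hY u).mul (hZ u)).pow_const _).add
          (((hY u).mul (hZ u)).mul ((hR u).pow_const r))).aemeasurable).trans ?_
        exact tsum_congr fun u => lintegral_add_left (((hY u).mul (hZ u)).pow_const _) _
    _ ≤ ∑' u, ((∫⁻ t, powerSum p t ^ (1 + r) ∂ν) * ∫⁻ ω, Z u ω ^ (1 + r) ∂P +
          ∫⁻ ω, Z u ω * S ω ^ r ∂P) :=
        ENNReal.tsum_le_tsum fun u => add_le_add (hfirst u).le (hsecond u)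
    _ ≤ _ := by
        rw [ENNReal.tsum_add, ENNReal.tsum_mul_left, add_comm]
        exact add_le_add_left hgrow _

/-- The intrinsic martingale along the generations is bounded in some moment of order
greater than one. -/
theorem exists_lintegral_intrinsicSum_rpow_le [IsProbabilityMeasure P] [IsProbabilityMeasure ν]
    {p₀ : ℝ} (hν : MalthusianHypotheses ν p₀) (hs : 0 ≤ s) :
    ∃ r : ℝ, 0 < r ∧ ∃ K : ℝ≥0∞, K ≠ ⊤ ∧ ∀ n,
      ∫⁻ ω, intrinsicSum p₀ (generation n) (markedTree α ξ e s ω) ^ (1 + r) ∂P ≤ K := by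
  obtain ⟨r, hr0, hr1, hρ, hC⟩ := hν.exists_exponent
  have hq : 0 ≤ 1 + r := by linarith
  have hpq : p₀ * (1 + r) ≠ 0 := (mul_pos hν.pos (by linarith)).ne'
  set C := ∫⁻ t, powerSum p₀ t ^ (1 + r) ∂ν
  set ρ := reproMoment ν (p₀ * (1 + r))
  set z := ENNReal.ofReal (s ^ (p₀ * (1 + r)))
  -- The root contributes `z` and the passage from generation `k` to `k + 1` adds at most `C * (ρ ^
  -- k * z)`; the series is finite because `ρ < 1`.
  refine ⟨r, hr0, z + ∑' k, C * (ρ ^ k * z), ?_, fun n => ?_⟩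
  · rw [ENNReal.tsum_mul_left, ENNReal.tsum_mul_right, ENNReal.tsum_geometric]
    refine ENNReal.add_ne_top.2 ⟨ENNReal.ofReal_ne_top, ENNReal.mul_ne_top hC.ne
      (ENNReal.mul_ne_top ?_ ENNReal.ofReal_ne_top)⟩
    exact ENNReal.inv_ne_top.2 (tsub_pos_of_lt hρ).ne'
  · have hpow : ∀ u, ∫⁻ ω, nodeWeight α ξ e s p₀ u ω ^ (1 + r) ∂P =
        ∫⁻ ω, nodeWeight α ξ e s (p₀ * (1 + r)) u ω ∂P := fun u =>
      lintegral_congr_ae ((h.ae_nodeWeight_rpow hs p₀ hq).mono fun ω hω => hω u)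
    have key : ∫⁻ ω, intrinsicSum p₀ (generation n) (markedTree α ξ e s ω) ^ (1 + r) ∂P ≤
        z + ∑ k ∈ Finset.range n, C * (ρ ^ k * z) := by
      induction n with
      | zero =>
        have h0 : generation 0 = {[]} := Set.ext fun u => List.length_eq_zero_iff
        have hroot : ∀ ω, intrinsicSum p₀ (generation 0) (markedTree α ξ e s ω) =
            nodeWeight α ξ e s p₀ [] ω := fun ω => by
          rw [intrinsicSum_eq, h0]
          exact tsum_singleton ([] : Node) fun u : Node => nodeWeight α ξ e s p₀ u ω
        simp only [hroot]
        rw [hpow]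
        simp [nodeWeight, markedTree_root, mkMark, z]
      | succ n ih =>
        refine (h.lintegral_intrinsicSum_rpow_succ_le hs hν.pos.ne' hν.reproMoment_eq_one
          hr0 hr1 n).trans ?_
        rw [Finset.sum_range_succ, ← add_assoc]
        simp only [hpow]
        rw [h.tsum_lintegral_nodeWeight_generation hs hpq]
        exact add_le_add_left ih _
    exact key.trans (add_le_add_right (ENNReal.sum_le_tsum _) _)

end IsReproductionFamily

end

/-! ### Conditional expectations along lines and the limit of the intrinsic martingale -/

/-- The limit of the intrinsic martingale along the generations. -/
def intrinsicLimit (p₀ : ℝ) (T : MarkedTree) : ℝ :=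
  (Filter.limsup (fun n => intrinsicSum p₀ (generation n) T) Filter.atTop).toReal

/-- The upper limit exists in `[0, ∞]` for every tree, so one function serves all root sizes. -/
theorem measurable_intrinsicLimit (p₀ : ℝ) : Measurable (intrinsicLimit p₀) := by
  refine (Measurable.limsup fun n => measurable_ennreal_tsum fun u => ?_).ennreal_toReal
  exact ((measurable_pi_apply (u : Node)).fst.pow_const p₀).ennreal_ofReal

theorem isLine_singleton (u : Node) : IsLine {u} := by
  rintro _ rfl _ rfl _
  rfl

section

variable {Ω : Type*} {α : ℝ} {ξ : Node → Ω → ℕ → ℝ} {e : Node → Ω → ℝ} {s p₀ : ℝ}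

theorem stronglyMeasurable_intrinsic_preSigma (Q : Set Node) :
    StronglyMeasurable[preSigma ξ e Q] fun ω => intrinsic p₀ Q (markedTree α ξ e s ω) :=
  (measurable_intrinsicSum_preSigma p₀ Q).ennreal_toReal.stronglyMeasurable

theorem preSigma_mono_of_precedes {L Q : Set Node} (hL : IsLine L) (hLQ : Precedes L Q)
    (hQ : Q ∈ coveringLines) : preSigma ξ e L ≤ preSigma ξ e Q :=
  preSigma_mono fun _ hl => hLQ.exists_progeny hL (coversRoot_of_mem_coveringLines hQ) hl

theorem precedes_generation {m n : ℕ} (h : m ≤ n) : Precedes (generation m) (generation n) := by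
  intro v hv
  have hv' : v.length = n := hv
  exact ⟨v.take m, by simp [generation, hv', h], List.take_prefix m v⟩

variable [MeasurableSpace Ω] {P : Measure Ω} [IsProbabilityMeasure P]
  {ν : Measure FinitePointMeasure} [IsProbabilityMeasure ν]

namespace IsReproductionFamily

variable (h : IsReproductionFamily P ν ξ e) (hν : MalthusianHypotheses ν p₀) (hs : 0 ≤ s)

/-- The filtration of the generations. -/
def generationFiltration (h : IsReproductionFamily P ν ξ e) :
    Filtration ℕ ‹MeasurableSpace Ω› where
  seq n := preSigma ξ e (generation n)
  mono' _ _ hmn := preSigma_mono_of_precedes (isLine_generation _) (precedes_generation hmn)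
    (generation_mem_coveringLines _)
  le' _ := h.preSigma_le _

include h hν hs

/-- Every line follows the line `{[]}`, whose sum is the constant `s ^ p₀`. -/
theorem lintegral_intrinsicSum_lt_top {Q : Set Node} (hQ : IsLine Q) :
    ∫⁻ ω, intrinsicSum p₀ Q (markedTree α ξ e s ω) ∂P < ⊤ := by
  have h1 := h.setLIntegral_intrinsicSum_le (α := α) hν hs (isLine_singleton []) hQ
    (fun v _ => ⟨[], rfl, List.nil_prefix⟩) (A := Set.univ) MeasurableSet.univ
  rw [Measure.restrict_univ] at h1
  refine h1.trans_lt ?_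
  have hroot : ∀ ω, intrinsicSum p₀ {[]} (markedTree α ξ e s ω) = ENNReal.ofReal (s ^ p₀) :=
    fun ω => tsum_singleton ([] : Node) fun u : Node => nodeWeight α ξ e s p₀ u ω
  simp [hroot]

theorem ae_intrinsicSum_lt_top {Q : Set Node} (hQ : IsLine Q) :
    ∀ᵐ ω ∂P, intrinsicSum p₀ Q (markedTree α ξ e s ω) < ⊤ :=
  ae_lt_top (h.measurable_intrinsicSum p₀ Q) (h.lintegral_intrinsicSum_lt_top hν hs hQ).ne

theorem integrable_intrinsic {Q : Set Node} (hQ : IsLine Q) :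
    Integrable (fun ω => intrinsic p₀ Q (markedTree α ξ e s ω)) P :=
  integrable_toReal_of_lintegral_ne_top (h.measurable_intrinsicSum p₀ Q).aemeasurable
    (h.lintegral_intrinsicSum_lt_top hν hs hQ).ne

theorem setIntegral_intrinsic {Q : Set Node} (hQ : IsLine Q) (A : Set Ω) :
    ∫ ω in A, intrinsic p₀ Q (markedTree α ξ e s ω) ∂P =
      (∫⁻ ω in A, intrinsicSum p₀ Q (markedTree α ξ e s ω) ∂P).toReal :=
  integral_toReal (h.measurable_intrinsicSum p₀ Q).aemeasurable
    (ae_restrict_of_ae (h.ae_intrinsicSum_lt_top hν hs hQ))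

theorem condExp_intrinsic_le {L Q : Set Node} (hL : IsLine L) (hQ : IsLine Q)
    (hLQ : Precedes L Q) :
    P[fun ω => intrinsic p₀ Q (markedTree α ξ e s ω) | preSigma ξ e L]
      ≤ᵐ[P] fun ω => intrinsic p₀ L (markedTree α ξ e s ω) := by
  have hle := h.preSigma_le L
  have hintL := h.integrable_intrinsic (α := α) hν hs hL
  have hintQ := h.integrable_intrinsic (α := α) hν hs hQ
  -- For the trimmed measure, only sets of `preSigma ξ e L` have to be tested.
  refine ae_le_of_ae_le_trim (hm := hle) (ae_le_of_forall_setIntegral_le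
    (integrable_condExp.trim hle stronglyMeasurable_condExp)
    (hintL.trim hle (stronglyMeasurable_intrinsic_preSigma L)) fun A hA _ => ?_)
  rw [← setIntegral_trim hle stronglyMeasurable_condExp hA,
    ← setIntegral_trim hle (stronglyMeasurable_intrinsic_preSigma L) hA,
    setIntegral_condExp hle hintQ hA, h.setIntegral_intrinsic hν hs hQ,
    h.setIntegral_intrinsic hν hs hL]
  refine ENNReal.toReal_mono ?_ (h.setLIntegral_intrinsicSum_le hν hs hL hQ hLQ hA)
  exact ((setLIntegral_le_lintegral _ _).trans_lt (h.lintegral_intrinsicSum_lt_top hν hs hL)).ne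

theorem condExp_intrinsic_eq {L Q : Set Node} (hL : IsLine L) (hQ : IsLine Q)
    (hfin : maxGeneration Q < ⊤) (hLQ : Covers Q L) :
    P[fun ω => intrinsic p₀ Q (markedTree α ξ e s ω) | preSigma ξ e L]
      =ᵐ[P] fun ω => intrinsic p₀ L (markedTree α ξ e s ω) := by
  refine (ae_eq_condExp_of_forall_setIntegral_eq (h.preSigma_le L)
    (h.integrable_intrinsic hν hs hQ)
    (fun A _ _ => (h.integrable_intrinsic hν hs hL).integrableOn) (fun A hA _ => ?_)
    (stronglyMeasurable_intrinsic_preSigma L).aestronglyMeasurable).symm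
  rw [h.setIntegral_intrinsic hν hs hQ, h.setIntegral_intrinsic hν hs hL,
    h.setLIntegral_intrinsicSum_eq hν hs hL hQ hfin hLQ hA]

theorem martingale_intrinsic_generation :
    Martingale (fun n ω => intrinsic p₀ (generation n) (markedTree α ξ e s ω))
      h.generationFiltration P := by
  refine ⟨fun n => stronglyMeasurable_intrinsic_preSigma (generation n), fun m n hmn => ?_⟩
  exact h.condExp_intrinsic_eq hν hs (isLine_generation m) (isLine_generation n)
    (generation_mem_coveringLines n).2.2 ⟨precedes_generation hmn, fun x _ =>
      coversRoot_of_mem_coveringLines (generation_mem_coveringLines n) x⟩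

theorem uniformIntegrable_intrinsic_generation :
    UniformIntegrable (fun n ω => intrinsic p₀ (generation n) (markedTree α ξ e s ω)) 1 P := by
  obtain ⟨r, hr, K, hK, hle⟩ := h.exists_lintegral_intrinsicSum_rpow_le (α := α) hν hs
  exact uniformIntegrable_toReal_of_lintegral_rpow_le
    (fun n => h.measurable_intrinsicSum p₀ (generation n)) hr hK hle

/-- The martingale is bounded in `L¹`, hence converges a.s. As all the sums are a.s. finite,
`toReal` commutes with the limit, which is thus the upper limit in `intrinsicLimit`. -/
theorem ae_tendsto_intrinsic_generation :
    ∀ᵐ ω ∂P, Filter.Tendsto (fun n => intrinsic p₀ (generation n) (markedTree α ξ e s ω))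
      Filter.atTop (nhds (intrinsicLimit p₀ (markedTree α ξ e s ω))) := by
  have hfin : ∀ᵐ ω ∂P, ∀ n, intrinsicSum p₀ (generation n) (markedTree α ξ e s ω) < ⊤ :=
    ae_all_iff.2 fun n => h.ae_intrinsicSum_lt_top hν hs (isLine_generation n)
  obtain ⟨R, hR⟩ := (h.uniformIntegrable_intrinsic_generation (α := α) hν hs).2.2
  filter_upwards [hfin, (h.martingale_intrinsic_generation (α := α) hν
    hs).submartingale.exists_ae_tendsto_of_bdd hR] with ω hω ⟨c, hlim⟩
  have h0 := ge_of_tendsto' hlim fun n => (ENNReal.toReal_nonneg :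
    0 ≤ intrinsic p₀ (generation n) (markedTree α ξ e s ω))
  have hlim' := (ENNReal.continuous_ofReal.tendsto _).comp hlim
  have heq : (ENNReal.ofReal ∘ fun n => intrinsic p₀ (generation n) (markedTree α ξ e s ω)) =
      fun n => intrinsicSum p₀ (generation n) (markedTree α ξ e s ω) :=
    funext fun n => ENNReal.ofReal_toReal (hω n).ne
  rw [heq] at hlim'
  rwa [intrinsicLimit, hlim'.limsup_eq, ENNReal.toReal_ofReal h0]

theorem integrable_intrinsicLimit :
    Integrable (fun ω => intrinsicLimit p₀ (markedTree α ξ e s ω)) P := by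
  have hUI := h.uniformIntegrable_intrinsic_generation (α := α) hν hs
  exact hUI.integrable_of_tendstoInMeasure
    (tendstoInMeasure_of_tendsto_ae hUI.1 (h.ae_tendsto_intrinsic_generation hν hs))

theorem tendsto_eLpNorm_intrinsic_generation :
    Filter.Tendsto (fun n => eLpNorm ((fun ω => intrinsic p₀ (generation n) (markedTree α ξ e s ω)) -
      fun ω => intrinsicLimit p₀ (markedTree α ξ e s ω)) 1 P) Filter.atTop (nhds 0) := by
  have hUI := h.uniformIntegrable_intrinsic_generation (α := α) hν hs
  exact tendsto_Lp_finite_of_tendsto_ae le_rfl ENNReal.one_ne_top hUI.1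
    (memLp_one_iff_integrable.2 (h.integrable_intrinsicLimit hν hs)) hUI.2.1
    (h.ae_tendsto_intrinsic_generation hν hs)

/-- For late `m`, `M_L` is the conditional expectation of the generation-`m` sum, and conditioning
contracts `L¹`; letting `m` grow, the distance to the conditional expectation of the limit vanishes.
-/
theorem intrinsic_ae_eq_condExp {L : Set Node} (hL : L ∈ coveringLines) :
    (fun ω => intrinsic p₀ L (markedTree α ξ e s ω)) =ᵐ[P]
      P[fun ω => intrinsicLimit p₀ (markedTree α ξ e s ω) | preSigma ξ e L] := by
  set f : ℕ → Ω → ℝ := fun n ω => intrinsic p₀ (generation n) (markedTree α ξ e s ω)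
  set g : Ω → ℝ := fun ω => intrinsicLimit p₀ (markedTree α ξ e s ω)
  have hg : Integrable g P := h.integrable_intrinsicLimit hν hs
  have hfi : ∀ n, Integrable (f n) P := fun n =>
    h.integrable_intrinsic hν hs (isLine_generation n)
  have hLm : AEStronglyMeasurable (fun ω => intrinsic p₀ L (markedTree α ξ e s ω)) P :=
    (h.integrable_intrinsic hν hs hL.1).aestronglyMeasurable
  obtain ⟨n, hn⟩ := exists_covers_generation hL
  have hle : ∀ m, n ≤ m → eLpNorm ((fun ω => intrinsic p₀ L (markedTree α ξ e s ω)) -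
      P[g | preSigma ξ e L]) 1 P ≤ eLpNorm (f m - g) 1 P := fun m hm => by
    have h1 := h.condExp_intrinsic_eq (α := α) hν hs hL.1 (isLine_generation m)
      (generation_mem_coveringLines m).2.2 (hn m hm)
    have h2 := (condExp_sub (hfi m) hg (preSigma ξ e L)).trans (h1.sub Filter.EventuallyEq.rfl)
    rw [← eLpNorm_congr_ae h2]
    exact eLpNorm_condExp_le_eLpNorm _ le_rfl
  have h0 := le_antisymm (ge_of_tendsto (h.tendsto_eLpNorm_intrinsic_generation hν hs)
    (Filter.eventually_atTop.2 ⟨n, hle⟩)) zero_le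
  rw [eLpNorm_eq_zero_iff (hLm.sub integrable_condExp.aestronglyMeasurable) one_ne_zero] at h0
  exact (sub_ae_eq_zero _ _).1 h0

theorem uniformIntegrable_intrinsic_coveringLines :
    UniformIntegrable (fun (L : coveringLines) (ω : Ω) =>
      intrinsic p₀ (L : Set Node) (markedTree α ξ e s ω)) 1 P :=
  ((h.integrable_intrinsicLimit hν hs).uniformIntegrable_condExp
    fun L : coveringLines => h.preSigma_le (L : Set Node)).ae_eq
      fun L => (h.intrinsic_ae_eq_condExp hν hs L.2).symm

theorem exists_eLpNorm_intrinsic_sub_lt {ε : ℝ≥0∞} (hε : 0 < ε) :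
    ∃ L₀ ∈ coveringLines, ∀ L ∈ coveringLines, Precedes L₀ L →
      eLpNorm (fun ω => intrinsic p₀ L (markedTree α ξ e s ω)
        - intrinsicLimit p₀ (markedTree α ξ e s ω)) 1 P < ε := by
  set f : ℕ → Ω → ℝ := fun n ω => intrinsic p₀ (generation n) (markedTree α ξ e s ω)
  set g : Ω → ℝ := fun ω => intrinsicLimit p₀ (markedTree α ξ e s ω)
  have hg : Integrable g P := h.integrable_intrinsicLimit hν hs
  have hfi : ∀ n, Integrable (f n) P := fun n =>
    h.integrable_intrinsic hν hs (isLine_generation n)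
  obtain ⟨n, hn⟩ := ((h.tendsto_eLpNorm_intrinsic_generation (α := α) hν hs).eventually
    (gt_mem_nhds (ENNReal.half_pos hε.ne'))).exists
  refine ⟨generation n, generation_mem_coveringLines n, fun L hL hnL => ?_⟩
  -- As `L` follows generation `n`, conditioning fixes `f n`, so `M_L - g` is `f n - g` minus its
  -- own conditional expectation; each part has norm below `ε / 2`.
  have hmeas : StronglyMeasurable[preSigma ξ e L] (f n) :=
    (stronglyMeasurable_intrinsic_preSigma (generation n)).mono
      (preSigma_mono_of_precedes (isLine_generation n) hnL hL)
  have hcond : P[f n | preSigma ξ e L] = f n :=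
    condExp_of_stronglyMeasurable (h.preSigma_le L) hmeas (hfi n)
  have heq : (fun ω => intrinsic p₀ L (markedTree α ξ e s ω) - g ω) =ᵐ[P]
      (f n - g) - P[f n - g | preSigma ξ e L] := by
    filter_upwards [h.intrinsic_ae_eq_condExp (α := α) hν hs hL,
      condExp_sub (hfi n) hg (preSigma ξ e L)] with ω h1 h2
    simp only [Pi.sub_apply] at h2 ⊢
    rw [h2, hcond, h1]
    ring
  rw [eLpNorm_congr_ae heq]
  refine (eLpNorm_sub_le ((hfi n).sub hg).aestronglyMeasurable
    integrable_condExp.aestronglyMeasurable le_rfl).trans_lt ?_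
  rw [← ENNReal.add_halves ε]
  exact ENNReal.add_lt_add hn ((eLpNorm_condExp_le_eLpNorm _ le_rfl).trans_lt hn)

theorem ae_tendsto_intrinsic {σ : ℕ → Set Node} (hσ : ∀ n, σ n ∈ coveringLines)
    (hmono : ∀ n, Precedes (σ n) (σ (n + 1))) (hex : ∀ x : Node, ∃ n, ∃ y ∈ σ n, x <+: y) :
    ∀ᵐ ω ∂P, Filter.Tendsto (fun n => intrinsic p₀ (σ n) (markedTree α ξ e s ω))
      Filter.atTop (nhds (intrinsicLimit p₀ (markedTree α ξ e s ω))) := by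
  let ℱ : Filtration ℕ ‹MeasurableSpace Ω› :=
    { seq := fun n => preSigma ξ e (σ n)
      mono' := monotone_nat_of_le_succ fun n =>
        preSigma_mono_of_precedes (hσ n).1 (hmono n) (hσ (n + 1))
      le' := fun _ => h.preSigma_le _ }
  -- Since each node has progeny in some `σ n`, the limit is measurable for the join of the
  -- filtration, so Lévy's theorem returns the limit itself rather than a projection.
  have hw : ∀ u : Node, Measurable[⨆ n, ℱ n] (nodeWeight α ξ e s p₀ u) := fun u => by
    obtain ⟨n, hn⟩ := hex u
    exact (measurable_nodeWeight_preSigma hn p₀).mono (le_iSup (fun n => ℱ n) n) le_rfl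
  have hmeas : Measurable[⨆ n, ℱ n] fun ω => intrinsicLimit p₀ (markedTree α ξ e s ω) :=
    (Measurable.limsup fun n => measurable_ennreal_tsum fun u : generation n =>
      hw (u : Node)).ennreal_toReal
  have hall : ∀ᵐ ω ∂P, ∀ n, intrinsic p₀ (σ n) (markedTree α ξ e s ω) =
      (P[fun ω => intrinsicLimit p₀ (markedTree α ξ e s ω) | preSigma ξ e (σ n)]) ω :=
    ae_all_iff.2 fun n => h.intrinsic_ae_eq_condExp hν hs (hσ n)
  filter_upwards [hall, (h.integrable_intrinsicLimit (α := α) hν hs).tendsto_ae_condExp (ℱ := ℱ)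
    hmeas.stronglyMeasurable] with ω h1 h2
  exact h2.congr fun n => (h1 n).symm

end IsReproductionFamily

end

end

theorem mainTheorem9 {Ω : Type*} [MeasurableSpace Ω] (P : Measure Ω) [IsProbabilityMeasure P]
    (ν : Measure FinitePointMeasure) [IsProbabilityMeasure ν]
    (α : ℝ) (hα : 0 ≤ α) (p₀ : ℝ) (hν : MalthusianHypotheses ν p₀)
    (hm : ∫⁻ s : FinitePointMeasure, (s : Measure ℝ) Set.univ ∂ν < ⊤)
    (ξ : Node → Ω → ℕ → ℝ) (e : Node → Ω → ℝ) (hξe : IsReproductionFamily P ν ξ e) :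
    -- the conditional expectations along lines
    (∀ s : ℝ, 0 < s → ∀ L Q : Set Node, IsLine L → IsLine Q → Precedes L Q →
      ∫⁻ ω, intrinsicSum p₀ Q (markedTree α ξ e s ω) ∂P < ⊤ ∧
      Integrable (fun ω => intrinsic p₀ Q (markedTree α ξ e s ω)) P ∧
      P[fun ω => intrinsic p₀ Q (markedTree α ξ e s ω) | preSigma ξ e L]
        ≤ᵐ[P] (fun ω => intrinsic p₀ L (markedTree α ξ e s ω)) ∧
      (maxGeneration Q < ⊤ → Covers Q L →
        P[fun ω => intrinsic p₀ Q (markedTree α ξ e s ω) | preSigma ξ e L]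
          =ᵐ[P] (fun ω => intrinsic p₀ L (markedTree α ξ e s ω)))) ∧
    -- uniform integrability
    (∀ s : ℝ, 0 < s →
      UniformIntegrable (fun (L : coveringLines) (ω : Ω) =>
        intrinsic p₀ (L : Set Node) (markedTree α ξ e s ω)) 1 P) ∧
    -- the limit variable, one function of the marked tree for all root sizes
    (∃ M : MarkedTree → ℝ, Measurable M ∧ (∀ T, 0 ≤ M T) ∧ ∀ s : ℝ, 0 < s →
      Integrable (fun ω => M (markedTree α ξ e s ω)) P ∧
      (∀ L ∈ coveringLines,
        (fun ω => intrinsic p₀ L (markedTree α ξ e s ω)) =ᵐ[P]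
          P[fun ω => M (markedTree α ξ e s ω) | preSigma ξ e L]) ∧
      (∀ ε : ℝ≥0∞, 0 < ε → ∃ L₀ ∈ coveringLines, ∀ L ∈ coveringLines, Precedes L₀ L →
        eLpNorm (fun ω => intrinsic p₀ L (markedTree α ξ e s ω)
          - M (markedTree α ξ e s ω)) 1 P < ε) ∧
      (∀ σ : ℕ → Set Node, (∀ n, σ n ∈ coveringLines) → (∀ n, Precedes (σ n) (σ (n + 1))) →
        (∀ x : Node, ∃ n, ∃ y ∈ σ n, x <+: y) →
        ∀ᵐ ω ∂P, Filter.Tendsto (fun n => intrinsic p₀ (σ n) (markedTree α ξ e s ω))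
          Filter.atTop (nhds (M (markedTree α ξ e s ω))))) := by
  refine ⟨fun s hs L Q hL hQ hLQ => ⟨hξe.lintegral_intrinsicSum_lt_top hν hs.le hQ,
    hξe.integrable_intrinsic hν hs.le hQ, hξe.condExp_intrinsic_le hν hs.le hL hQ hLQ,
    fun hfin hcov => hξe.condExp_intrinsic_eq hν hs.le hL hQ hfin hcov⟩,
    fun s hs => hξe.uniformIntegrable_intrinsic_coveringLines hν hs.le,
    intrinsicLimit p₀, measurable_intrinsicLimit p₀, fun _ => ENNReal.toReal_nonneg,
    fun s hs => ⟨hξe.integrable_intrinsicLimit hν hs.le,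
      fun L hL => hξe.intrinsic_ae_eq_condExp hν hs.le hL,
      fun ε hε => hξe.exists_eLpNorm_intrinsic_sub_lt hν hs.le hε,
      fun σ hσ hmono hex => hξe.ae_tendsto_intrinsic hν hs.le hσ hmono hex⟩⟩
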